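/- Let $n,d,T\ge 0$ and $k\ge 1$ be integers, $\sigma\ge 0$, $p\in(0,1]$, $\delta\in(0,1)$, and let $0\prec\Gamma_{\mathrm{sb}}\preceq\overline\Gamma$ be symmetric $d\times d$ matrices and $A_*\in\mathbb{R}^{n\times d}$. On a probability space with a filtration $(\mathcal F_t)_{t\ge 0}$ let $X_t\in\mathbb{R}^d$ and $\eta_t\in\mathbb{R}^n$ $(1\le t\le T)$ be random vectors such that $X_t$ is $\mathcal F_t$-measurable and $\eta_t$ is $\mathcal F_{t+1}$-measurable (for example $\mathcal F_t=\sigma(\eta_0,\dots,\eta_{t-1},X_1,\dots,X_t)$). Assume: (a) $Y_t=A_*X_t+\eta_t$ for $1\le t\le T$, where $\mathbb{E}[\eta_t\mid\mathcal F_t]=0$ and $\eta_t$ is conditionally $\sigma^2$-sub-Gaussian, i.e. $\mathbb{E}[\exp(\lambda\langle v,\eta_t\rangle)\mid\mathcal F_t]\le e^{\sigma^2\lambda^2/2}$ almost surely for every unit vector $v\in\mathbb{R}^n$ and every $\lambda\in\mathbb{R}$; (b) $X_1,\dots,X_T$ satisfies the $(k,\Gamma_{\mathrm{sb}},p)$-block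 martingale small-ball condition: for every unit vector $w\in\mathbb{R}^d$ and every $j\ge 0$ with $j+k\le T$, almost surely $$\frac1k\sum_{i=1}^k\Pr\left(|\langle w,X_{j+i}\rangle|\ge\sqrt{w^\top\Gamma_{\mathrm{sb}}w}\;\middle|\;\mathcal F_j\right)\ge p;$$ (c) $\Pr\left[\sum_{t=1}^T X_tX_t^\top\npreceq T\overline\Gamma\right]\le\delta$. Suppose further that $$T\ge\frac{10k}{p^2}\left(\log\frac1\delta+2d\log\frac{10}{p}+\log\det(\overline\Gamma\,\Gamma_{\mathrm{sb}}^{-1})\right),$$ and let $\widehat A(T)\in\arg\min_{A\in\mathbb{R}^{n\times d}}\sum_{t=1}^T\frac12\|Y_t-AX_t\|_2^2$ be any ordinary least-squares estimator. Then, with $\|\cdot\|_{\mathrm{op}}$ the Euclidean operator norm and $\lambda_{\min}$ the smallest eigenvalue, $$\Pr\left[\|\widehat A(T)-A_*\|_{\mathrm{op}}>\frac{90\sigma}{p}\sqrt{\frac{n+d\log\frac{10}{p}+\log\det(\overline\Gamma\,\Gamma_{\mathrm{sb}}^{-1})+\log\frac1\delta}{T\,\lambda_{\min}(\Gamma_{\mathrm{sb}})}}\;\right]\le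 3\delta.$$ -/

import Mathlib

open MeasureTheory ProbabilityTheory

/-- The spectral (Euclidean operator) norm of a real `n × d` matrix. -/
noncomputable def opNorm {n d : ℕ} (M : Matrix (Fin n) (Fin d) ℝ) : ℝ :=
  ‖LinearMap.toContinuousLinearMap (Matrix.toEuclideanLin M)‖

/-- The smallest (real) eigenvalue of a square matrix; used for symmetric matrices. -/
noncomputable def lambdaMin {d : ℕ} (M : Matrix (Fin d) (Fin d) ℝ) : ℝ :=
  sInf (spectrum ℝ M)

/-- The Loewner order `A ⪯ B`. -/
def LoewnerLE {d : ℕ} (A B : Matrix (Fin d) (Fin d) ℝ) : Prop :=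
  (B - A).PosSemidef

/-- The (uncentered) empirical covariance `∑_{t=1}^T x_t x_tᵀ`. -/
def gram {d : ℕ} (T : ℕ) (x : ℕ → EuclideanSpace ℝ (Fin d)) : Matrix (Fin d) (Fin d) ℝ :=
  ∑ t ∈ Finset.Icc 1 T, Matrix.vecMulVec (x t).ofLp (x t).ofLp

/-- The least-squares objective `∑_{t=1}^T ½ ‖y_t - A x_t‖²`. -/
noncomputable def lsLoss {n d : ℕ} (T : ℕ) (x : ℕ → EuclideanSpace ℝ (Fin d))
    (y : ℕ → EuclideanSpace ℝ (Fin n)) (A : Matrix (Fin n) (Fin d) ℝ) : ℝ :=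
  ∑ t ∈ Finset.Icc 1 T, (1 / 2 : ℝ) * ‖y t - Matrix.toEuclideanLin A (x t)‖ ^ 2

/-- `Ahat` is an ordinary least-squares estimate from `(x_1, y_1), …, (x_T, y_T)`. The minimizer
need not be unique. -/
def IsOLS {n d : ℕ} (T : ℕ) (x : ℕ → EuclideanSpace ℝ (Fin d))
    (y : ℕ → EuclideanSpace ℝ (Fin n)) (Ahat : Matrix (Fin n) (Fin d) ℝ) : Prop :=
  ∀ A : Matrix (Fin n) (Fin d) ℝ, lsLoss T x y Ahat ≤ lsLoss T x y A

/-- Conditionally on `m`, the random vector `W` has mean zero. -/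
def CondMeanZero {Ω : Type*} {mΩ : MeasurableSpace Ω} (μ : Measure Ω) {n : ℕ}
    (m : MeasurableSpace Ω) (W : Ω → EuclideanSpace ℝ (Fin n)) : Prop :=
  Integrable W μ ∧ μ[W | m] =ᵐ[μ] 0

/-- Conditionally on `m`, the random vector `W` is `σ²`-sub-Gaussian: in every unit direction `v`
one has `𝔼[exp(c ⟨v, W⟩) | m] ≤ exp(σ² c² / 2)` almost surely, for all real `c`. -/
def CondSubGaussian {Ω : Type*} {mΩ : MeasurableSpace Ω} (μ : Measure Ω) {n : ℕ}
    (m : MeasurableSpace Ω) (σ : ℝ) (W : Ω → EuclideanSpace ℝ (Fin n)) : Prop :=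
  ∀ v : EuclideanSpace ℝ (Fin n), ‖v‖ = 1 → ∀ c : ℝ,
    Integrable (fun ω => Real.exp (c * inner ℝ v (W ω))) μ ∧
    ∀ᵐ ω ∂μ, (μ[fun ω' => Real.exp (c * inner ℝ v (W ω')) | m]) ω
      ≤ Real.exp (σ ^ 2 * c ^ 2 / 2)

/-- The scalar process `Z_1, …, Z_T`, adapted to `ℱ`, satisfies the `(k, ν, p)`-block martingale
small-ball condition: for every block `j+1, …, j+k` inside `1, …, T`, almost surely
`(1/k) ∑_{i=1}^k ℙ(|Z_{j+i}| ≥ ν | ℱ_j) ≥ p`. -/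
def IsBMSB {Ω : Type*} {mΩ : MeasurableSpace Ω} (μ : Measure Ω) (ℱ : Filtration ℕ mΩ)
    (T k : ℕ) (ν p : ℝ) (Z : ℕ → Ω → ℝ) : Prop :=
  (∀ t ∈ Finset.Icc 1 T, Measurable[ℱ t] (Z t)) ∧
  ∀ j : ℕ, j + k ≤ T → ∀ᵐ ω ∂μ,
    p ≤ (1 / (k : ℝ)) * ∑ i ∈ Finset.Icc 1 k,
      (μ[{ω' | ν ≤ |Z (j + i) ω'|}.indicator (fun _ => (1 : ℝ)) | ℱ j]) ω

/-- The vector process `X_1, …, X_T` satisfies the `(k, Γ, p)`-block martingale small-ball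
condition: for every unit vector `w`, the process `⟨w, X_t⟩` satisfies the scalar condition with
threshold `√(wᵀ Γ w)`. -/
def IsVectorBMSB {Ω : Type*} {mΩ : MeasurableSpace Ω} (μ : Measure Ω) (ℱ : Filtration ℕ mΩ)
    {d : ℕ} (T k : ℕ) (Γ : Matrix (Fin d) (Fin d) ℝ) (p : ℝ)
    (X : ℕ → Ω → EuclideanSpace ℝ (Fin d)) : Prop :=
  ∀ w : EuclideanSpace ℝ (Fin d), ‖w‖ = 1 →
    IsBMSB μ ℱ T k (Real.sqrt (w.ofLp ⬝ᵥ Γ.mulVec w.ofLp)) p (fun t ω => inner ℝ w (X t ω))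

/-!
The error `E = Ahat - Astar` of least squares satisfies the normal equations: with the Gram matrix
`S = ∑ X_t X_tᵀ`, the adjoint of `E` represents the noise in the sense that
`∑ ⟨l, X_t⟩ ⟨v, η_t⟩ = lᵀ S Eᵀv` for all `v`, `l`. It therefore suffices to bound `S` from below and
the energy `(Eᵀv)ᵀ S (Eᵀv)` from above, uniformly in the unit vector `v`.

*Lower bound.* In a fixed direction `w`, the exponential moments of the hit rates of `⌊T / k⌋`
successive blocks multiply, and a Chernoff bound gives `wᵀ S w ≳ p T wᵀ Γsb w` outside an event of
probability `exp (-(7/20) p ⌊T / k⌋)` (`IsBMSB.measure_sum_sq_lt_le`). To reach all directions at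
once, volumes are compared instead of counting a net. When `S ⪯ T Γbar`, one direction in which
`S ⪰ (p² / 50) T Γsb` fails forces a whole `Γbar`-ellipsoid of directions that are bad for the fixed
direction bound, while the expected volume of the latter is small; Markov's inequality concludes
(`IsVectorBMSB.measure_exists_deficient_le`). The ratio of the volumes of the two ellipsoids
produces `det (Γbar Γsb⁻¹)`.

*Upper bound.* For `‖v‖ ≤ 1`, the exponential of
`∑ (⟨l, X_t⟩ ⟨v, η_t⟩ - σ² ⟨l, X_t⟩² / 2)` has expectation at most `1`
(`lintegral_exp_selfNormalized_le_one`). It is integrated over `l` against a Gaussian weight with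
matrix proportional to `Γsb` (the method of mixtures) and over `v` in the unit ball. Completing the
square bounds the `l`-integral from below by the exponential of the energy times a Gaussian weight
(`exp_energy_mul_gaussWeight_le`), and averaging over a ball of radius `1 / 2` around `v₀ / 2` loses
only `2 ^ n` (`exp_energy_mul_volume_le`), so that Markov's inequality bounds all directions
simultaneously (`measure_energy_ge_le`).

Both the volumes and the Gaussian weights are integrals of a function of a quadratic form, so the
same change of variables (`lintegral_comp_quadForm`) evaluates all the ratios.
-/

/-! ### Quadratic forms, Gaussian weights and ellipsoids -/

/-- The quadratic form `w ↦ wᵀ M w`. -/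
def quadForm {d : ℕ} (M : Matrix (Fin d) (Fin d) ℝ) (w : EuclideanSpace ℝ (Fin d)) : ℝ :=
  w.ofLp ⬝ᵥ M.mulVec w.ofLp

lemma quadForm_smul_matrix {d : ℕ} (c : ℝ) (M : Matrix (Fin d) (Fin d) ℝ)
    (w : EuclideanSpace ℝ (Fin d)) : quadForm (c • M) w = c * quadForm M w := by
  simp [quadForm, Matrix.smul_mulVec]

lemma quadForm_smul {d : ℕ} (c : ℝ) (M : Matrix (Fin d) (Fin d) ℝ)
    (w : EuclideanSpace ℝ (Fin d)) : quadForm M (c • w) = c ^ 2 * quadForm M w := by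
  simp only [quadForm, WithLp.ofLp_smul, Matrix.mulVec_smul, dotProduct_smul, smul_dotProduct,
    smul_eq_mul]
  ring

lemma LoewnerLE.quadForm_le {d : ℕ} {A B : Matrix (Fin d) (Fin d) ℝ} (h : LoewnerLE A B)
    (w : EuclideanSpace ℝ (Fin d)) : quadForm A w ≤ quadForm B w := by
  have := h.dotProduct_mulVec_nonneg w.ofLp
  simp only [star_trivial, Matrix.sub_mulVec, dotProduct_sub] at this
  exact sub_nonneg.mp this

lemma quadForm_nonneg {d : ℕ} {M : Matrix (Fin d) (Fin d) ℝ} (hM : M.PosSemidef)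
    (w : EuclideanSpace ℝ (Fin d)) : 0 ≤ quadForm M w := by
  simpa [quadForm] using hM.dotProduct_mulVec_nonneg w.ofLp

lemma quadForm_pos {d : ℕ} {M : Matrix (Fin d) (Fin d) ℝ} (hM : M.PosDef)
    {w : EuclideanSpace ℝ (Fin d)} (hw : w ≠ 0) : 0 < quadForm M w := by
  have : w.ofLp ≠ 0 := by simpa using hw
  simpa [quadForm] using hM.dotProduct_mulVec_pos this

lemma quadForm_parallelogram {d : ℕ} (M : Matrix (Fin d) (Fin d) ℝ)
    (u v : EuclideanSpace ℝ (Fin d)) :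
    quadForm M (u + v) + quadForm M (u - v) = 2 * quadForm M u + 2 * quadForm M v := by
  simp only [quadForm, WithLp.ofLp_add, WithLp.ofLp_sub, Matrix.mulVec_add, Matrix.mulVec_sub,
    dotProduct_add, dotProduct_sub, add_dotProduct, sub_dotProduct]
  ring

lemma quadForm_gram {d : ℕ} (T : ℕ) (x : ℕ → EuclideanSpace ℝ (Fin d))
    (w : EuclideanSpace ℝ (Fin d)) :
    quadForm (gram T x) w = ∑ t ∈ Finset.Icc 1 T, (inner ℝ w (x t) : ℝ) ^ 2 := by
  simp only [quadForm, gram, Matrix.sum_mulVec, dotProduct_sum]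
  refine Finset.sum_congr rfl fun t _ => ?_
  rw [Matrix.vecMulVec_mulVec]
  simp only [dotProduct_smul, EuclideanSpace.inner_eq_star_dotProduct, star_trivial]
  simp [dotProduct_comm, sq]

lemma gram_posSemidef {d : ℕ} (T : ℕ) (x : ℕ → EuclideanSpace ℝ (Fin d)) :
    (gram T x).PosSemidef := by
  refine Matrix.posSemidef_sum _ fun t _ => ?_
  simpa using Matrix.posSemidef_vecMulVec_self_star (x t).ofLp

@[fun_prop]
lemma continuous_quadForm {d : ℕ} (M : Matrix (Fin d) (Fin d) ℝ) : Continuous (quadForm M) := by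
  unfold quadForm
  fun_prop

open scoped MatrixOrder in
/-- Change of variables: every integral of a function of a positive definite quadratic form is
`(det M)^{-1/2}` times the corresponding radial integral. -/
lemma lintegral_comp_quadForm {d : ℕ} {M : Matrix (Fin d) (Fin d) ℝ} (hM : M.PosDef)
    {h : ℝ → ENNReal} (hh : Measurable h) :
    ∫⁻ w, h (quadForm M w) =
      ENNReal.ofReal (Real.sqrt M.det)⁻¹ * ∫⁻ w : EuclideanSpace ℝ (Fin d), h (‖w‖ ^ 2) := by
  -- with `M = Bᵀ B` the form is `‖B w‖²`, and `det M = (det B)²`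
  obtain ⟨B, hB⟩ := CStarAlgebra.nonneg_iff_eq_star_mul_self.mp hM.posSemidef.nonneg
  have hdet : M.det = B.det ^ 2 := by
    rw [hB, Matrix.det_mul, Matrix.star_eq_conjTranspose, Matrix.det_conjTranspose]
    simp [sq]
  have hB0 : B.det ≠ 0 := fun h0 => by
    have := hM.det_pos
    simp [hdet, h0] at this
  have hq : ∀ w : EuclideanSpace ℝ (Fin d), quadForm M w = ‖Matrix.toEuclideanLin B w‖ ^ 2 := by
    intro w
    rw [← real_inner_self_eq_norm_sq, EuclideanSpace.inner_eq_star_dotProduct]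
    simp only [quadForm, hB, star_trivial, Matrix.ofLp_toLpLin, Matrix.toLin'_apply]
    rw [← Matrix.mulVec_mulVec, Matrix.dotProduct_mulVec, Matrix.star_eq_conjTranspose,
      Matrix.conjTranspose_eq_transpose_of_trivial, Matrix.vecMul_transpose]
  have hdL : LinearMap.det (Matrix.toEuclideanLin B) ≠ 0 := by
    rwa [Matrix.toEuclideanLin, LinearMap.det_toLpLin]
  have hmap := Measure.map_linearMap_addHaar_eq_smul_addHaar
    (volume : Measure (EuclideanSpace ℝ (Fin d))) hdL
  have hm : Measurable (Matrix.toEuclideanLin B) :=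
    (LinearMap.continuous_of_finiteDimensional _).measurable
  simp_rw [hq]
  rw [← lintegral_map (f := fun w : EuclideanSpace ℝ (Fin d) => h (‖w‖ ^ 2)) (by fun_prop) hm,
    hmap, lintegral_smul_measure, smul_eq_mul, Matrix.toEuclideanLin, LinearMap.det_toLpLin,
    hdet, Real.sqrt_sq_eq_abs, abs_inv]

lemma quadForm_ge_lambdaMin {d : ℕ} {M : Matrix (Fin d) (Fin d) ℝ} (hM : M.PosDef)
    (w : EuclideanSpace ℝ (Fin d)) : lambdaMin M * ‖w‖ ^ 2 ≤ quadForm M w := by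
  have hfin : (spectrum ℝ M).Finite := by
    rw [hM.isHermitian.spectrum_real_eq_range_eigenvalues]; exact Set.finite_range _
  have hps : (M - lambdaMin M • (1 : Matrix (Fin d) (Fin d) ℝ)).PosSemidef := by
    rw [Matrix.posSemidef_iff_isHermitian_and_spectrum_nonneg]
    constructor
    · exact hM.isHermitian.sub (Matrix.isHermitian_one.smul (by simp [IsSelfAdjoint]))
    · intro x hx
      have : x + lambdaMin M ∈ spectrum ℝ M := by
        rw [← Algebra.algebraMap_eq_smul_one] at hx
        rw [spectrum.mem_iff] at hx ⊢
        convert hx using 2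
        rw [map_add]; abel
      have h2 : lambdaMin M ≤ x + lambdaMin M := csInf_le hfin.bddBelow this
      simpa using h2
  have := hps.dotProduct_mulVec_nonneg w.ofLp
  simp only [star_trivial, Matrix.sub_mulVec, dotProduct_sub, Matrix.smul_mulVec,
    Matrix.one_mulVec, dotProduct_smul, smul_eq_mul] at this
  have hn : ‖w‖ ^ 2 = w.ofLp ⬝ᵥ w.ofLp := by
    rw [← real_inner_self_eq_norm_sq, EuclideanSpace.inner_eq_star_dotProduct, star_trivial]
  rw [hn]
  exact sub_nonneg.mp this

lemma lambdaMin_pos {d : ℕ} (hd : d ≠ 0) {M : Matrix (Fin d) (Fin d) ℝ} (hM : M.PosDef) :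
    0 < lambdaMin M := by
  have : Nonempty (Fin d) := ⟨⟨0, Nat.pos_of_ne_zero hd⟩⟩
  have hsp := hM.isHermitian.spectrum_real_eq_range_eigenvalues
  have hmem : lambdaMin M ∈ spectrum ℝ M := by
    refine Set.Nonempty.csInf_mem ?_ ?_ <;> rw [hsp]
    · exact Set.range_nonempty _
    · exact Set.finite_range _
  rw [hsp] at hmem
  obtain ⟨i, hi⟩ := hmem
  rw [← hi]
  exact hM.eigenvalues_pos i

lemma posDef_of_loewnerLE {d : ℕ} {A B : Matrix (Fin d) (Fin d) ℝ} (hA : A.PosDef)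
    (h : LoewnerLE A B) : B.PosDef := by
  have := hA.add_posSemidef h
  rwa [add_sub_cancel] at this

/-- The integrals of the same function of two positive definite forms differ by a determinant
factor, whatever the function. -/
lemma lintegral_comp_quadForm_ratio {d : ℕ} {A B : Matrix (Fin d) (Fin d) ℝ} (hA : A.PosDef)
    (hB : B.PosDef) {h : ℝ → ENNReal} (hh : Measurable h) :
    ∫⁻ w, h (quadForm A w) =
      ENNReal.ofReal (Real.sqrt (B.det / A.det)) * ∫⁻ w, h (quadForm B w) := by
  have hB0 := Real.sqrt_pos.mpr hB.det_pos
  rw [lintegral_comp_quadForm hA hh, lintegral_comp_quadForm hB hh, ← mul_assoc,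
    ← ENNReal.ofReal_mul (Real.sqrt_nonneg _), Real.sqrt_div hB.det_pos.le]
  congr 2
  field_simp

lemma det_smul_div_det_smul {d : ℕ} {A B : Matrix (Fin d) (Fin d) ℝ} (hA : A.PosDef)
    (s t : ℝ) :
    (t • B).det / (s • A).det = (t / s) ^ d * (B * A⁻¹).det := by
  have := hA.det_pos
  rw [Matrix.det_smul, Matrix.det_smul, Matrix.det_mul, Matrix.det_nonsing_inv,
    Ring.inverse_eq_inv', Fintype.card_fin, div_pow]
  field_simp

/-- The Gaussian weight `∫ exp(-wᵀ M w) dw` of a positive definite matrix. -/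
noncomputable def gaussWeight {d : ℕ} (M : Matrix (Fin d) (Fin d) ℝ) : ENNReal :=
  ∫⁻ w : EuclideanSpace ℝ (Fin d), ENNReal.ofReal (Real.exp (-quadForm M w))

lemma gaussWeight_ratio {d : ℕ} {A B : Matrix (Fin d) (Fin d) ℝ} (hA : A.PosDef)
    (hB : B.PosDef) :
    gaussWeight A = ENNReal.ofReal (Real.sqrt (B.det / A.det)) * gaussWeight B :=
  lintegral_comp_quadForm_ratio hA hB (h := fun x => ENNReal.ofReal (Real.exp (-x)))
    (by fun_prop)

lemma gaussWeight_ne_zero {d : ℕ} (M : Matrix (Fin d) (Fin d) ℝ) : gaussWeight M ≠ 0 := by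
  unfold gaussWeight
  rw [← pos_iff_ne_zero, lintegral_pos_iff_support (by fun_prop)]
  have : (Function.support fun w : EuclideanSpace ℝ (Fin d) =>
      ENNReal.ofReal (Real.exp (-quadForm M w))) = Set.univ := by
    ext w; simp [Real.exp_pos]
  rw [this]
  exact isOpen_univ.measure_pos _ Set.univ_nonempty

lemma gaussWeight_ne_top {d : ℕ} {M : Matrix (Fin d) (Fin d) ℝ} (hM : M.PosDef) :
    gaussWeight M ≠ ⊤ := by
  have hint : Integrable fun w : EuclideanSpace ℝ (Fin d) => Real.exp (-1 * ‖w‖ ^ 2) := by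
    by_contra hni
    have h1 := GaussianFourier.integral_rexp_neg_mul_sq_norm
      (V := EuclideanSpace ℝ (Fin d)) one_pos
    rw [integral_undef hni] at h1
    have : 0 < (Real.pi / 1) ^ ((Module.finrank ℝ (EuclideanSpace ℝ (Fin d)) : ℝ) / 2) := by
      positivity
    exact this.ne h1
  have hlt := hint.lintegral_lt_top
  unfold gaussWeight
  rw [lintegral_comp_quadForm hM (h := fun x => ENNReal.ofReal (Real.exp (-x))) (by fun_prop)]
  refine ENNReal.mul_ne_top ENNReal.ofReal_ne_top ?_
  simpa using hlt.ne

lemma gaussWeight_anti {d : ℕ} {A B : Matrix (Fin d) (Fin d) ℝ}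
    (h : ∀ w, quadForm A w ≤ quadForm B w) : gaussWeight B ≤ gaussWeight A := by
  refine lintegral_mono fun w => ENNReal.ofReal_le_ofReal (Real.exp_le_exp.mpr ?_)
  linarith [h w]

/-- The determinant is monotone for the Loewner order on positive definite matrices, because the
Gaussian weight is antitone. -/
lemma one_le_det_mul_inv {d : ℕ} {A B : Matrix (Fin d) (Fin d) ℝ} (hA : A.PosDef)
    (h : LoewnerLE A B) : 1 ≤ (B * A⁻¹).det := by
  have hB := posDef_of_loewnerLE hA h
  have h1 : gaussWeight B ≤ gaussWeight A := gaussWeight_anti h.quadForm_le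
  rw [gaussWeight_ratio hA hB] at h1
  by_contra hlt
  push Not at hlt
  have h2 := det_smul_div_det_smul hA (B := B) 1 1
  simp only [one_smul, div_one, one_pow, one_mul] at h2
  rw [← h2] at hlt
  have h3 : ENNReal.ofReal (Real.sqrt (B.det / A.det)) < 1 := by
    rw [ENNReal.ofReal_lt_one, Real.sqrt_lt' one_pos]
    simpa using hlt
  have h4 := ENNReal.mul_lt_mul_left (gaussWeight_ne_zero B) (gaussWeight_ne_top hB) h3
  rw [one_mul] at h4
  exact absurd h1 (not_le.mpr h4)

lemma volume_quadForm_le_eq {d : ℕ} (M : Matrix (Fin d) (Fin d) ℝ) :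
    volume {w : EuclideanSpace ℝ (Fin d) | quadForm M w ≤ 1} =
      ∫⁻ w, (Set.Iic (1 : ℝ)).indicator (1 : ℝ → ENNReal) (quadForm M w) := by
  rw [← lintegral_indicator_one (measurableSet_le (by fun_prop) measurable_const)]
  rfl

lemma volume_quadForm_le_ratio {d : ℕ} {A B : Matrix (Fin d) (Fin d) ℝ} (hA : A.PosDef)
    (hB : B.PosDef) :
    volume {w : EuclideanSpace ℝ (Fin d) | quadForm A w ≤ 1} =
      ENNReal.ofReal (Real.sqrt (B.det / A.det)) *
        volume {w : EuclideanSpace ℝ (Fin d) | quadForm B w ≤ 1} := by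
  rw [volume_quadForm_le_eq, volume_quadForm_le_eq]
  exact lintegral_comp_quadForm_ratio hA hB (measurable_one.indicator measurableSet_Iic)

lemma volume_quadForm_le_ne_zero {d : ℕ} (M : Matrix (Fin d) (Fin d) ℝ) :
    volume {w : EuclideanSpace ℝ (Fin d) | quadForm M w ≤ 1} ≠ 0 := by
  have ho : IsOpen {w : EuclideanSpace ℝ (Fin d) | quadForm M w < 1} :=
    isOpen_lt (by fun_prop) continuous_const
  have hne : {w : EuclideanSpace ℝ (Fin d) | quadForm M w < 1}.Nonempty := ⟨0, by simp [quadForm]⟩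
  refine ((ho.measure_pos volume hne).trans_le (measure_mono fun w hw => ?_)).ne'
  rw [Set.mem_ofPred_eq] at hw
  exact hw.le

lemma volume_quadForm_le_ne_top {d : ℕ} {M : Matrix (Fin d) (Fin d) ℝ} (hM : M.PosDef) :
    volume {w : EuclideanSpace ℝ (Fin d) | quadForm M w ≤ 1} ≠ ⊤ := by
  rw [volume_quadForm_le_ratio hM Matrix.PosDef.one]
  refine ENNReal.mul_ne_top ENNReal.ofReal_ne_top ?_
  refine ((measure_mono fun w hw => ?_).trans_lt
    (measure_closedBall_lt_top (x := (0 : EuclideanSpace ℝ (Fin d))) (r := 1))).ne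
  rw [Set.mem_ofPred_eq, quadForm, Matrix.one_mulVec] at hw
  rw [mem_closedBall_zero_iff, ← sq_le_one_iff₀ (norm_nonneg w), ← real_inner_self_eq_norm_sq,
    EuclideanSpace.inner_eq_star_dotProduct, star_trivial]
  exact hw

/-! ### Small-ball bound in one direction -/

lemma integral_mul_condExp_of_bound {Ω : Type*} {m mΩ : MeasurableSpace Ω} {μ : Measure Ω}
    [IsProbabilityMeasure μ] (hm : m ≤ mΩ) {f g : Ω → ℝ} (hf : StronglyMeasurable[m] f)
    (hg : Integrable g μ) (c : ℝ) (hb : ∀ ω, ‖f ω‖ ≤ c) :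
    ∫ ω, f ω * g ω ∂μ = ∫ ω, f ω * (μ[g | m]) ω ∂μ := by
  have h := condExp_stronglyMeasurable_mul_of_bound (μ := μ) hm hf hg c (ae_of_all _ hb)
  rw [← integral_condExp hm (f := fun ω => f ω * g ω)]
  exact integral_congr_ae h

lemma sum_blocks (f : ℕ → ℝ) (k m : ℕ) :
    ∑ l ∈ Finset.range m, ∑ i ∈ Finset.Icc 1 k, f (l * k + i) =
      ∑ t ∈ Finset.Icc 1 (m * k), f t := by
  induction m with
  | zero => simp
  | succ m ih =>
    rw [Finset.sum_range_succ, ih, add_mul, one_mul]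
    have h : ∀ a : ℕ, Finset.Icc 1 a = Finset.Ioc 0 a := fun a => rfl
    rw [h, h, h, ← Finset.sum_Ioc_consecutive f (Nat.zero_le (m * k)) (Nat.le_add_right _ k)]
    congr 1
    have h2 := Finset.image_add_left_Ioc 0 k (m * k)
    rw [add_zero] at h2
    rw [← h2, Finset.sum_image fun a _ b _ hab => Nat.add_left_cancel hab]

/-- The chord of `exp (-x)` over `[0, 1]`, with the slope `1 - 1 / e` rounded down to `3 / 5`. -/
lemma exp_neg_le_chord {x : ℝ} (h0 : 0 ≤ x) (h1 : x ≤ 1) : Real.exp (-x) ≤ 1 - 3 / 5 * x := by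
  have h := convexOn_exp.2 (Set.mem_univ (0 : ℝ)) (Set.mem_univ (-1 : ℝ))
    (sub_nonneg.mpr h1) h0 (by ring)
  have he : Real.exp (-1) ≤ 2 / 5 := by
    rw [Real.exp_neg, inv_le_comm₀ (Real.exp_pos _) (by norm_num)]
    linarith [Real.exp_one_gt_d9]
  simp only [smul_eq_mul, mul_zero, zero_add, Real.exp_zero, mul_one, mul_neg] at h
  nlinarith

/-- The indicator that `|Z_t|` reaches the threshold `ν`. -/
noncomputable def hit {Ω : Type*} (ν : ℝ) (Z : ℕ → Ω → ℝ) (t : ℕ) : Ω → ℝ :=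
  {ω | ν ≤ |Z t ω|}.indicator fun _ => (1 : ℝ)

/-- The fraction of hits in the block `j + 1, …, j + k`. -/
noncomputable def hitRate {Ω : Type*} (ν : ℝ) (Z : ℕ → Ω → ℝ) (k j : ℕ) (ω : Ω) : ℝ :=
  (1 / (k : ℝ)) * ∑ i ∈ Finset.Icc 1 k, hit ν Z (j + i) ω

lemma hit_nonneg {Ω : Type*} {ν : ℝ} {Z : ℕ → Ω → ℝ} (t : ℕ) (ω : Ω) : 0 ≤ hit ν Z t ω :=
  Set.indicator_nonneg (fun _ _ => zero_le_one) _

lemma hit_le_one {Ω : Type*} {ν : ℝ} {Z : ℕ → Ω → ℝ} (t : ℕ) (ω : Ω) : hit ν Z t ω ≤ 1 :=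
  Set.indicator_le_self' (fun _ _ => zero_le_one) _

lemma hitRate_nonneg {Ω : Type*} {ν : ℝ} {Z : ℕ → Ω → ℝ} {k : ℕ} (j : ℕ) (ω : Ω) :
    0 ≤ hitRate ν Z k j ω :=
  mul_nonneg (by positivity) (Finset.sum_nonneg fun _ _ => hit_nonneg _ _)

lemma hitRate_le_one {Ω : Type*} {ν : ℝ} {Z : ℕ → Ω → ℝ} {k : ℕ} (hk : 1 ≤ k) (j : ℕ)
    (ω : Ω) : hitRate ν Z k j ω ≤ 1 := by
  have hk' : (0 : ℝ) < k := by exact_mod_cast hk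
  have : ∑ i ∈ Finset.Icc 1 k, hit ν Z (j + i) ω ≤ k := by
    refine (Finset.sum_le_sum fun i _ => hit_le_one (j + i) ω).trans ?_
    simp
  unfold hitRate
  rw [one_div, inv_mul_le_iff₀ hk']
  simpa using this

section BlockSmallBall

variable {Ω : Type*} {mΩ : MeasurableSpace Ω} {μ : Measure Ω}
  {ℱ : Filtration ℕ mΩ} {T k : ℕ} {ν p : ℝ} {Z : ℕ → Ω → ℝ}

lemma IsBMSB.measurable_hit (h : IsBMSB μ ℱ T k ν p Z) {t : ℕ} (ht : t ∈ Finset.Icc 1 T) :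
    Measurable[ℱ t] (hit ν Z t) := by
  have hZ := h.1 t ht
  refine Measurable.indicator (m := ℱ t) measurable_const ?_
  exact @measurableSet_le _ _ _ _ _ (_) _ _ _ _ _ measurable_const
    (continuous_abs.measurable.comp hZ)

lemma IsBMSB.measurable_hitRate (h : IsBMSB μ ℱ T k ν p Z) {j s : ℕ} (hj : j + k ≤ T)
    (hs : j + k ≤ s) : Measurable[ℱ s] (hitRate ν Z k j) := by
  refine Measurable.const_mul (m := ℱ s) ?_ _
  refine Finset.measurable_fun_sum (m := ℱ s) _ fun i hi => ?_
  rw [Finset.mem_Icc] at hi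
  exact (h.measurable_hit (Finset.mem_Icc.mpr ⟨by omega, by omega⟩)).mono (ℱ.mono (by omega)) le_rfl

variable [IsProbabilityMeasure μ]

/-- One block: conditionally on the past, the exponential moment of the hit rate is at most
`exp (-(3/5) p)`. -/
lemma IsBMSB.integral_mul_exp_neg_hitRate_le (h : IsBMSB μ ℱ T k ν p Z) (hk : 1 ≤ k) {j : ℕ}
    (hj : j + k ≤ T) {f : Ω → ℝ} (hf : Measurable[ℱ j] f) (hf0 : ∀ ω, 0 ≤ f ω)
    (hf1 : ∀ ω, f ω ≤ 1) :
    ∫ ω, f ω * Real.exp (-hitRate ν Z k j ω) ∂μ ≤ Real.exp (-(3 / 5 * p)) * ∫ ω, f ω ∂μ := by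
  have hfm : Measurable f := hf.mono (ℱ.le j) le_rfl
  have hfb : ∀ ω, ‖f ω‖ ≤ 1 := fun ω => by rw [Real.norm_of_nonneg (hf0 ω)]; exact hf1 ω
  have hfi : Integrable f μ := .of_bound hfm.aestronglyMeasurable 1 (ae_of_all _ hfb)
  have hhm : ∀ i ∈ Finset.Icc 1 k, Measurable (hit ν Z (j + i)) := fun i hi => by
    rw [Finset.mem_Icc] at hi
    exact (h.measurable_hit (Finset.mem_Icc.mpr ⟨by omega, by omega⟩)).mono (ℱ.le _) le_rfl
  have hhb : ∀ t ω, ‖hit ν Z t ω‖ ≤ 1 := fun t ω => by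
    rw [Real.norm_of_nonneg (hit_nonneg _ _)]; exact hit_le_one _ _
  have hhi : ∀ i ∈ Finset.Icc 1 k, Integrable (hit ν Z (j + i)) μ := fun i hi =>
    .of_bound (hhm i hi).aestronglyMeasurable 1 (ae_of_all _ (hhb _))
  have hrm : Measurable (hitRate ν Z k j) := (h.measurable_hitRate hj le_rfl).mono (ℱ.le _) le_rfl
  have hri : Integrable (fun ω => f ω * hitRate ν Z k j ω) μ := by
    refine .of_bound (hfm.mul hrm).aestronglyMeasurable 1 (ae_of_all _ fun ω => ?_)
    rw [Real.norm_of_nonneg (mul_nonneg (hf0 ω) (hitRate_nonneg _ _))]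
    exact mul_le_one₀ (hf1 ω) (hitRate_nonneg _ _) (hitRate_le_one hk _ _)
  have hei : Integrable (fun ω => f ω * Real.exp (-hitRate ν Z k j ω)) μ := by
    refine .of_bound (by fun_prop) 1 (ae_of_all _ fun ω => ?_)
    rw [Real.norm_of_nonneg (mul_nonneg (hf0 ω) (Real.exp_pos _).le)]
    refine mul_le_one₀ (hf1 ω) (Real.exp_pos _).le ?_
    rw [Real.exp_le_one_iff]
    linarith [hitRate_nonneg (ν := ν) (Z := Z) (k := k) j ω]
  have hpi : ∀ i ∈ Finset.Icc 1 k, Integrable (fun ω => f ω * (μ[hit ν Z (j + i) | ℱ j]) ω) μ :=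
    fun i _ => integrable_condExp.bdd_mul hfm.aestronglyMeasurable (ae_of_all _ hfb)
  have hlow : p * ∫ ω, f ω ∂μ ≤ ∫ ω, f ω * hitRate ν Z k j ω ∂μ := by
    have e1 : ∫ ω, f ω * hitRate ν Z k j ω ∂μ =
        (1 / (k : ℝ)) * ∑ i ∈ Finset.Icc 1 k, ∫ ω, f ω * (μ[hit ν Z (j + i) | ℱ j]) ω ∂μ := by
      rw [← Finset.sum_congr rfl fun i hi => integral_mul_condExp_of_bound (ℱ.le j)
        hf.stronglyMeasurable (hhi i hi) 1 hfb, ← integral_finsetSum, ← integral_const_mul]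
      · refine integral_congr_ae (ae_of_all _ fun ω => ?_)
        simp only [hitRate, ← Finset.mul_sum]
        ring
      · exact fun i hi => (hhi i hi).bdd_mul hfm.aestronglyMeasurable (ae_of_all _ hfb)
    rw [e1, ← integral_finsetSum _ hpi, ← integral_const_mul, ← integral_const_mul]
    refine integral_mono_ae (hfi.const_mul p)
      ((integrable_finsetSum _ hpi).const_mul _) ?_
    filter_upwards [h.2 j hj] with ω hω
    have := mul_le_mul_of_nonneg_left hω (hf0 ω)
    simp only [← Finset.mul_sum]
    unfold hit
    linarith
  calc ∫ ω, f ω * Real.exp (-hitRate ν Z k j ω) ∂μ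
      ≤ ∫ ω, (f ω - 3 / 5 * (f ω * hitRate ν Z k j ω)) ∂μ := by
        refine integral_mono hei (hfi.sub (hri.const_mul _)) fun ω => ?_
        have := mul_le_mul_of_nonneg_left (exp_neg_le_chord
          (hitRate_nonneg (ν := ν) (Z := Z) (k := k) j ω) (hitRate_le_one hk j ω)) (hf0 ω)
        simp only
        linarith
    _ = ∫ ω, f ω ∂μ - 3 / 5 * ∫ ω, f ω * hitRate ν Z k j ω ∂μ := by
        rw [integral_sub hfi (hri.const_mul _), integral_const_mul]
    _ ≤ (1 - 3 / 5 * p) * ∫ ω, f ω ∂μ := by linarith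
    _ ≤ Real.exp (-(3 / 5 * p)) * ∫ ω, f ω ∂μ := by
        refine mul_le_mul_of_nonneg_right ?_ (integral_nonneg hf0)
        linarith [Real.add_one_le_exp (-(3 / 5 * p))]

lemma IsBMSB.integral_exp_neg_sum_hitRate_le (h : IsBMSB μ ℱ T k ν p Z) (hk : 1 ≤ k) (m : ℕ)
    (hm : m * k ≤ T) :
    ∫ ω, Real.exp (-∑ l ∈ Finset.range m, hitRate ν Z k (l * k) ω) ∂μ
      ≤ Real.exp (-(3 / 5 * p * m)) := by
  induction m with
  | zero => simp
  | succ m ih =>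
    rw [add_mul, one_mul] at hm
    have hstep := h.integral_mul_exp_neg_hitRate_le hk hm
      (f := fun ω => Real.exp (-∑ l ∈ Finset.range m, hitRate ν Z k (l * k) ω)) ?_
      (fun ω => (Real.exp_pos _).le) ?_
    · simp only [← Real.exp_add] at hstep
      calc _ = ∫ ω, Real.exp (-∑ l ∈ Finset.range m, hitRate ν Z k (l * k) ω
                + -hitRate ν Z k (m * k) ω) ∂μ := by
            simp only [Finset.sum_range_succ, neg_add]
        _ ≤ _ := hstep
        _ ≤ Real.exp (-(3 / 5 * p)) * Real.exp (-(3 / 5 * p * m)) :=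
            mul_le_mul_of_nonneg_left (ih (by omega)) (Real.exp_pos _).le
        _ = _ := by rw [← Real.exp_add]; push_cast; ring_nf
    · refine Real.measurable_exp.comp ?_
      refine Measurable.neg (m := ℱ (m * k)) ?_
      refine Finset.measurable_fun_sum (m := ℱ (m * k)) _ fun l hl => ?_
      have hl' := Finset.mem_range.mp hl
      have : l * k + k ≤ m * k := by
        calc l * k + k = (l + 1) * k := by ring
          _ ≤ m * k := Nat.mul_le_mul_right k hl'
      exact h.measurable_hitRate (by omega) this
    · intro ω
      rw [Real.exp_le_one_iff, neg_nonpos]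
      exact Finset.sum_nonneg fun _ _ => hitRate_nonneg _ _

/-- Block small-ball conditions force the energy `∑ Z_t²` to be of order `m k p ν²`, except with
probability exponentially small in the number `m` of blocks. -/
lemma IsBMSB.measure_sum_sq_lt_le (h : IsBMSB μ ℱ T k ν p Z) (hk : 1 ≤ k) (hν : 0 ≤ ν) (m : ℕ)
    (hm : m * k ≤ T) :
    μ {ω | ∑ t ∈ Finset.Icc 1 T, Z t ω ^ 2 < 1 / 4 * p * (m * k) * ν ^ 2}
      ≤ ENNReal.ofReal (Real.exp (-(7 / 20 * p * m))) := by
  have hk' : (0 : ℝ) < k := by exact_mod_cast hk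
  set B : Ω → ℝ := fun ω => ∑ l ∈ Finset.range m, hitRate ν Z k (l * k) ω with hB
  have hBm : Measurable B := by
    refine Finset.measurable_fun_sum _ fun l hl => ?_
    have : l * k + k ≤ T := by
      calc l * k + k = (l + 1) * k := by ring
        _ ≤ m * k := Nat.mul_le_mul_right k (Finset.mem_range.mp hl)
        _ ≤ T := hm
    exact (h.measurable_hitRate this le_rfl).mono (ℱ.le _) le_rfl
  have hB0 : ∀ ω, 0 ≤ B ω := fun ω => Finset.sum_nonneg fun _ _ => hitRate_nonneg _ _
  have hsub : {ω | ∑ t ∈ Finset.Icc 1 T, Z t ω ^ 2 < 1 / 4 * p * (m * k) * ν ^ 2} ⊆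
      {ω | Real.exp (-(1 / 4 * p * m)) ≤ Real.exp (-B ω)} := by
    intro ω hω
    simp only [Set.mem_ofPred_eq, Real.exp_le_exp, neg_le_neg_iff] at hω ⊢
    by_contra hlt
    push Not at hlt
    have e1 : ∑ t ∈ Finset.Icc 1 (m * k), hit ν Z t ω = k * B ω := by
      rw [← sum_blocks (fun t => hit ν Z t ω), hB, Finset.mul_sum]
      refine Finset.sum_congr rfl fun l _ => ?_
      simp only [hitRate]
      field_simp
    have e2 : ν ^ 2 * (k * B ω) ≤ ∑ t ∈ Finset.Icc 1 T, Z t ω ^ 2 := by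
      rw [← e1, Finset.mul_sum]
      refine (Finset.sum_le_sum fun t _ => ?_).trans
        (Finset.sum_le_sum_of_subset_of_nonneg (Finset.Icc_subset_Icc_right hm)
          fun t _ _ => sq_nonneg _)
      by_cases hmem : ν ≤ |Z t ω|
      · have : hit ν Z t ω = 1 := Set.indicator_of_mem (s := {ω | ν ≤ |Z t ω|}) hmem _
        rw [this, mul_one, ← sq_abs (Z t ω)]
        exact pow_le_pow_left₀ hν hmem 2
      · have : hit ν Z t ω = 0 := Set.indicator_of_notMem (s := {ω | ν ≤ |Z t ω|}) hmem _
        rw [this, mul_zero]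
        positivity
    have e3 : 1 / 4 * p * (m * k) * ν ^ 2 ≤ ν ^ 2 * (k * B ω) := by
      have := mul_le_mul_of_nonneg_left hlt.le (mul_nonneg (sq_nonneg ν) hk'.le)
      linarith
    linarith
  have hint : Integrable (fun ω => Real.exp (-B ω)) μ := by
    refine .of_bound (by fun_prop) 1 (ae_of_all _ fun ω => ?_)
    rw [Real.norm_of_nonneg (Real.exp_pos _).le, Real.exp_le_one_iff]
    linarith [hB0 ω]
  have hmark := mul_meas_ge_le_integral_of_nonneg (ae_of_all _ fun ω => (Real.exp_pos (-B ω)).le)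
    hint (Real.exp (-(1 / 4 * p * m)))
  have hE := h.integral_exp_neg_sum_hitRate_le hk m hm
  refine (measure_mono hsub).trans ?_
  rw [← ofReal_measureReal]
  refine ENNReal.ofReal_le_ofReal ?_
  have h3 := hmark.trans hE
  have h4 : Real.exp (-(3 / 5 * p * m)) =
      Real.exp (-(1 / 4 * p * m)) * Real.exp (-(7 / 20 * p * m)) := by
    rw [← Real.exp_add]; ring_nf
  rw [h4] at h3
  exact le_of_mul_le_mul_left h3 (Real.exp_pos _)

end BlockSmallBall

/-! ### Lower bound on the Gram matrix -/

section LowerBound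

variable {Ω : Type*} {mΩ : MeasurableSpace Ω} {μ : Measure Ω} [IsProbabilityMeasure μ]
  {d T k : ℕ} {p : ℝ} {Γsb Γbar : Matrix (Fin d) (Fin d) ℝ}
  {X : ℕ → Ω → EuclideanSpace ℝ (Fin d)} {ℱ : Filtration ℕ mΩ}

/-- The small-ball energy bound in one fixed direction. -/
lemma IsVectorBMSB.measure_quadForm_gram_lt_le (hsb : IsVectorBMSB μ ℱ T k Γsb p X) (hk : 1 ≤ k)
    (hΓ : Γsb.PosDef) {m : ℕ} (hm : m * k ≤ T) {c : ℝ} (hc : c ≤ 1 / 4 * p * (m * k))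
    (w : EuclideanSpace ℝ (Fin d)) :
    μ {ω | quadForm (gram T fun t => X t ω) w < c * quadForm Γsb w}
      ≤ ENNReal.ofReal (Real.exp (-(7 / 20 * p * m))) := by
  by_cases hw : w = 0
  · simp [hw, quadForm]
  have hw' : 0 < ‖w‖ := norm_pos_iff.mpr hw
  obtain ⟨u, hu, hwu⟩ : ∃ u : EuclideanSpace ℝ (Fin d), ‖u‖ = 1 ∧ w = ‖w‖ • u :=
    ⟨‖w‖⁻¹ • w, by rw [norm_smul, norm_inv, norm_norm, inv_mul_cancel₀ hw'.ne'],
      by rw [smul_smul, mul_inv_cancel₀ hw'.ne', one_smul]⟩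
  refine (measure_mono fun ω hω => ?_).trans
    ((hsb u hu).measure_sum_sq_lt_le hk (Real.sqrt_nonneg _) m hm)
  rw [Set.mem_ofPred_eq] at hω ⊢
  have hq := quadForm_nonneg hΓ.posSemidef u
  rw [hwu, quadForm_smul, quadForm_smul, mul_left_comm] at hω
  have h1 := lt_of_mul_lt_mul_left hω (sq_nonneg _)
  rw [quadForm_gram] at h1
  rw [← quadForm, Real.sq_sqrt hq]
  exact h1.trans_le (mul_le_mul_of_nonneg_right hc hq)

lemma measurable_quadForm_gram (hX : ∀ t ∈ Finset.Icc 1 T, Measurable (X t)) :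
    Measurable fun q : EuclideanSpace ℝ (Fin d) × Ω =>
      quadForm (gram T fun t => X t q.2) q.1 := by
  simp only [quadForm_gram]
  refine Finset.measurable_fun_sum _ fun t ht => ?_
  exact (measurable_fst.inner ((hX t ht).comp measurable_snd)).pow_const 2

/-- A deficient direction `w`, normalised by `wᵀ Γsb w = 1`, has deficient neighbours: if
`S ⪯ T Γbar` and the form of `S` at `w` is below `T p² / 50`, then at each point of the `Γbar`-ellipsoid of
radius `p / 8` around `w` it is below `T p / 5` times that of `Γsb`. -/
lemma quadForm_deficient_of_near {S : Matrix (Fin d) (Fin d) ℝ} {T : ℝ} (hT : 0 < T)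
    (hp0 : 0 < p) (hp1 : p ≤ 1) (hS : ∀ w, quadForm S w ≤ T * quadForm Γbar w)
    (hΓ : ∀ w, quadForm Γsb w ≤ quadForm Γbar w) {w u : EuclideanSpace ℝ (Fin d)}
    (hw : quadForm Γsb w = 1) (hSw : quadForm S w < T * p ^ 2 / 50)
    (hSp : 0 ≤ quadForm S (w - u)) (hΓp : 0 ≤ quadForm Γsb (w - u))
    (hΓp' : 0 ≤ quadForm Γsb (w + (2 : ℝ) • u))
    (hu : quadForm Γbar u ≤ p ^ 2 / 64) :
    quadForm S (w + u) < T * p / 5 * quadForm Γsb (w + u) ∧ quadForm Γsb (w + u) ≤ 4 := by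
  have hp2 : p ^ 2 ≤ p := by nlinarith
  have e1 := quadForm_parallelogram S w u
  have e2 := quadForm_parallelogram Γsb w u
  have e3 := quadForm_parallelogram Γsb (w + u) u
  have e4 : w + u + u = w + (2 : ℝ) • u := by rw [two_smul, add_assoc]
  rw [add_sub_cancel_right, e4] at e3
  have h1 := hS u
  have h2 := hΓ u
  have h3 : T * quadForm Γbar u ≤ T * (p ^ 2 / 64) := mul_le_mul_of_nonneg_left hu hT.le
  -- the parallelogram law stands in for the triangle inequality of the seminorms
  have hlow : 31 / 64 ≤ quadForm Γsb (w + u) := by nlinarith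
  have h4 : T * p / 5 * (31 / 64) ≤ T * p / 5 * quadForm Γsb (w + u) :=
    mul_le_mul_of_nonneg_left hlow (by positivity)
  have h5 : T * p ^ 2 ≤ T * p := mul_le_mul_of_nonneg_left hp2 hT.le
  have h6 : 0 < T * p := by positivity
  constructor <;> linarith

/-- Uniform lower bound on the Gram matrix. A deficient direction forces a fixed volume of deficient
directions, and the expected volume of those is controlled by the bound for fixed directions; this
replaces a net argument. -/
lemma IsVectorBMSB.measure_exists_deficient_le (hsb : IsVectorBMSB μ ℱ T k Γsb p X) (hk : 1 ≤ k)
    (hX : ∀ t ∈ Finset.Icc 1 T, Measurable (X t)) (hT : 0 < T)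
    (hΓ : Γsb.PosDef) (hΓle : LoewnerLE Γsb Γbar) (hp0 : 0 < p) (hp1 : p ≤ 1) {m : ℕ}
    (hm : m * k ≤ T) (hc : T * p / 5 ≤ 1 / 4 * p * (m * k)) :
    μ {ω | LoewnerLE (gram T fun t => X t ω) ((T : ℝ) • Γbar) ∧
        ∃ w, quadForm (gram T fun t => X t ω) w < T * p ^ 2 / 50 * quadForm Γsb w}
      ≤ ENNReal.ofReal (Real.sqrt ((256 / p ^ 2) ^ d * (Γbar * Γsb⁻¹).det)
          * Real.exp (-(7 / 20 * p * m))) := by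
  have hT' : (0 : ℝ) < T := by exact_mod_cast hT
  have hbar := posDef_of_loewnerLE hΓ hΓle
  have hA : ((1 / 4 : ℝ) • Γsb).PosDef := hΓ.smul (by norm_num)
  have hB : ((64 / p ^ 2 : ℝ) • Γbar).PosDef := hbar.smul (by positivity)
  set K : Set (EuclideanSpace ℝ (Fin d)) := {w | quadForm ((1 / 4 : ℝ) • Γsb) w ≤ 1} with hK
  set U : Set (EuclideanSpace ℝ (Fin d)) := {w | quadForm ((64 / p ^ 2 : ℝ) • Γbar) w ≤ 1} with hU
  set D : Set (EuclideanSpace ℝ (Fin d) × Ω) :=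
    {q | quadForm (gram T fun t => X t q.2) q.1 < T * p / 5 * quadForm Γsb q.1} with hD
  have hDm : MeasurableSet D := measurableSet_lt (measurable_quadForm_gram hX) (by fun_prop)
  -- `Φ ω` is the volume of the deficient directions in `K`
  set Φ : Ω → ENNReal := fun ω => ∫⁻ w in K, D.indicator 1 (w, ω) with hΦ
  have hind : Measurable (D.indicator (1 : EuclideanSpace ℝ (Fin d) × Ω → ENNReal)) :=
    measurable_one.indicator hDm
  have hEΦ : ∫⁻ ω, Φ ω ∂μ ≤ volume K * ENNReal.ofReal (Real.exp (-(7 / 20 * p * m))) := by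
    rw [hΦ, lintegral_lintegral_swap (f := fun ω w =>
      D.indicator (1 : EuclideanSpace ℝ (Fin d) × Ω → ENNReal) (w, ω))
      (hind.comp measurable_swap).aemeasurable]
    calc _ ≤ ∫⁻ _ in K, ENNReal.ofReal (Real.exp (-(7 / 20 * p * m))) := by
          refine lintegral_mono fun w => ?_
          have : ∀ ω, D.indicator (1 : EuclideanSpace ℝ (Fin d) × Ω → ENNReal) (w, ω) =
              {ω | (w, ω) ∈ D}.indicator 1 ω := fun ω => rfl
          simp only [this]
          have hsec : MeasurableSet {ω | (w, ω) ∈ D} := measurable_prodMk_left hDm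
          rw [lintegral_indicator_one hsec]
          exact hsb.measure_quadForm_gram_lt_le hk hΓ hm hc w
      _ = _ := by rw [setLIntegral_const, mul_comm]
  have hsub : {ω | LoewnerLE (gram T fun t => X t ω) ((T : ℝ) • Γbar) ∧
        ∃ w, quadForm (gram T fun t => X t ω) w < T * p ^ 2 / 50 * quadForm Γsb w} ⊆
      {ω | volume U ≤ Φ ω} := by
    rintro ω ⟨hup, w, hw⟩
    have hw0 : w ≠ 0 := by rintro rfl; simp [quadForm] at hw
    have hq := quadForm_pos hΓ hw0
    -- normalise the deficient direction on the `Γsb`-ellipsoid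
    set s := (Real.sqrt (quadForm Γsb w))⁻¹ with hs
    have hs2 : s ^ 2 * quadForm Γsb w = 1 := by
      rw [hs, inv_pow, Real.sq_sqrt hq.le, inv_mul_cancel₀ hq.ne']
    have hs0 : 0 < s := inv_pos.mpr (Real.sqrt_pos.mpr hq)
    have hnear : ∀ u ∈ U, s • w + u ∈ K ∧ (s • w + u, ω) ∈ D := by
      intro u hu
      rw [hU, Set.mem_ofPred_eq, quadForm_smul_matrix, div_mul_eq_mul_div,
        div_le_one (by positivity)] at hu
      have hgp := quadForm_nonneg (gram_posSemidef T fun t => X t ω)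
      have hΓp := quadForm_nonneg hΓ.posSemidef
      have := quadForm_deficient_of_near hT' hp0 hp1
        (fun w => by simpa [quadForm_smul_matrix] using hup.quadForm_le w) hΓle.quadForm_le
        (w := s • w) (u := u) (by rw [quadForm_smul, hs2])
        (by
          rw [quadForm_smul]
          calc _ < s ^ 2 * (T * p ^ 2 / 50 * quadForm Γsb w) :=
                mul_lt_mul_of_pos_left hw (by positivity)
            _ = _ := by rw [mul_left_comm, hs2, mul_one])
        (hgp _) (hΓp _) (hΓp _) (by linarith)
      refine ⟨?_, this.1⟩
      rw [hK, Set.mem_ofPred_eq, quadForm_smul_matrix]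
      linarith [this.2]
    rw [Set.mem_ofPred_eq, hΦ]
    have e1 : ∀ v, D.indicator (1 : EuclideanSpace ℝ (Fin d) × Ω → ENNReal) (v, ω) =
        {v | (v, ω) ∈ D}.indicator 1 v :=
      fun v => rfl
    simp only [e1]
    have hsec : MeasurableSet {v | (v, ω) ∈ D} := measurable_prodMk_right hDm
    rw [lintegral_indicator_one hsec, Measure.restrict_apply hsec,
      ← measure_preimage_add volume (s • w) ({v | (v, ω) ∈ D} ∩ K)]
    exact measure_mono fun u hu => ⟨(hnear u hu).2, (hnear u hu).1⟩
  have hΦm : AEMeasurable Φ μ :=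
    (Measurable.lintegral_prod_left'
      (f := D.indicator (1 : EuclideanSpace ℝ (Fin d) × Ω → ENNReal)) hind).aemeasurable
  refine (measure_mono hsub).trans ?_
  refine (meas_ge_le_lintegral_div hΦm (volume_quadForm_le_ne_zero _)
    (volume_quadForm_le_ne_top hB)).trans ?_
  refine ENNReal.div_le_of_le_mul (hEΦ.trans_eq ?_)
  rw [hK, volume_quadForm_le_ratio hA hB, det_smul_div_det_smul hΓ,
    ENNReal.ofReal_mul (Real.sqrt_nonneg _)]
  have : (64 / p ^ 2 / (1 / 4) : ℝ) = 256 / p ^ 2 := by ring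
  rw [this]
  ring

end LowerBound

/-- The sample size assumption is large enough for the lower bound on the Gram matrix to fail with
probability at most `δ`, when the sample is cut into `⌊T / k⌋` blocks. -/
lemma block_count_bounds {d T k : ℕ} (hk : 1 ≤ k) (hd : 1 ≤ d) {p δ D : ℝ} (hp0 : 0 < p)
    (hp1 : p ≤ 1) (hδ0 : 0 < δ) (hδ1 : δ < 1) (hD : 1 ≤ D)
    (hT : (T : ℝ) ≥ 10 * (k : ℝ) / p ^ 2 *
      (Real.log (1 / δ) + 2 * (d : ℝ) * Real.log (10 / p) + Real.log D)) :
    T * p / 5 ≤ 1 / 4 * p * ((T / k : ℕ) * k) ∧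
    Real.sqrt ((256 / p ^ 2) ^ d * D) * Real.exp (-(7 / 20 * p * (T / k : ℕ))) ≤ δ := by
  set L := Real.log (1 / δ) + 2 * (d : ℝ) * Real.log (10 / p) + Real.log D with hL
  have hk' : (1 : ℝ) ≤ k := by exact_mod_cast hk
  have hd' : (1 : ℝ) ≤ d := by exact_mod_cast hd
  have hp10 : 10 ≤ 10 / p := by rw [le_div_iff₀ hp0]; linarith
  have hlog : 2 ≤ Real.log (10 / p) := by
    rw [Real.le_log_iff_exp_le (by positivity)]
    refine le_trans ?_ hp10
    have h1 : Real.exp 2 = Real.exp 1 ^ 2 := by rw [← Real.exp_nat_mul]; norm_num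
    rw [h1]
    nlinarith [Real.exp_one_lt_d9, Real.exp_pos 1]
  have hlogδ : 0 ≤ Real.log (1 / δ) := Real.log_nonneg (by rw [le_div_iff₀ hδ0]; linarith)
  have hlogD : 0 ≤ Real.log D := Real.log_nonneg hD
  -- as `d` is positive, the sample contains at least `40` blocks, and rounding costs little
  have hL4 : 4 ≤ L := by nlinarith
  have hp2 : 0 < p ^ 2 := by positivity
  have hp21 : p ^ 2 ≤ p := by nlinarith
  have hT2 : 10 * (k * L) ≤ T * p ^ 2 := by
    rw [ge_iff_le, div_mul_eq_mul_div, div_le_iff₀ hp2] at hT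
    linarith
  have hkL : k * 4 ≤ k * L := mul_le_mul_of_nonneg_left hL4 (by linarith)
  have hTp : (T : ℝ) * p ^ 2 ≤ T * p := mul_le_mul_of_nonneg_left hp21 (by positivity)
  have hTp' : (T : ℝ) * p ≤ T := mul_le_of_le_one_right (by positivity) hp1
  set m := T / k with hm
  have hfl : (T : ℝ) < (m + 1) * k := by
    have := Nat.lt_mul_of_div_lt (Nat.lt_succ_self (T / k)) hk
    exact_mod_cast (this : T < (m + 1) * k)
  have hmk : 4 / 5 * (T : ℝ) ≤ m * k := by linarith
  constructor
  · have := mul_le_mul_of_nonneg_left hmk hp0.le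
    linarith
  · have hmp : L ≤ 7 / 20 * p * m := by
      have h1 : 4 / 5 * (T : ℝ) * p ≤ m * k * p := mul_le_mul_of_nonneg_right hmk hp0.le
      have h2 : k * L ≤ k * (7 / 20 * p * m) := by nlinarith
      exact le_of_mul_le_mul_left h2 (by linarith)
    have hexp : Real.exp L = 1 / δ * ((10 / p) ^ 2) ^ d * D := by
      rw [hL, Real.exp_add, Real.exp_add, Real.exp_log (by positivity), Real.exp_log (by linarith),
        mul_comm 2 (d : ℝ), mul_assoc (d : ℝ), Real.exp_nat_mul, two_mul, Real.exp_add,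
        Real.exp_log (by positivity), ← sq]
    have hsq : Real.sqrt ((256 / p ^ 2) ^ d * D) ≤ ((10 / p) ^ 2) ^ d * D := by
      rw [Real.sqrt_le_left (by positivity), mul_pow, ← pow_mul, mul_comm d 2, pow_mul]
      have h1 : 256 / p ^ 2 ≤ ((10 / p) ^ 2) ^ 2 := by
        rw [div_pow, div_pow, ← pow_mul, div_le_div_iff₀ (by positivity) (by positivity)]
        have : p ^ 2 * p ^ 2 ≤ 1 * p ^ 2 := by gcongr; linarith
        norm_num
        nlinarith
      have h2 : D ≤ D ^ 2 := by nlinarith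
      gcongr
    calc _ ≤ ((10 / p) ^ 2) ^ d * D * Real.exp (-L) := by
          gcongr
      _ = δ := by
          rw [Real.exp_neg, hexp]
          field_simp

/-! ### The exponential supermartingale of the noise -/

lemma exists_finite_range_approx {Ω : Type*} [MeasurableSpace Ω] {a : Ω → ℝ}
    (ha : Measurable a) : ∃ b : ℕ → Ω → ℝ, (∀ n, Measurable (b n)) ∧
      (∀ n, (Set.range (b n)).Finite) ∧
      ∀ ω, Filter.Tendsto (fun n => b n ω) Filter.atTop (nhds (a ω)) :=
  ⟨fun n => ha.stronglyMeasurable.approx n, fun _ => SimpleFunc.measurable _,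
    fun _ => SimpleFunc.finite_range _, ha.stronglyMeasurable.tendsto_approx⟩

section Supermartingale

variable {Ω : Type*} {m mΩ : MeasurableSpace Ω} {μ : Measure Ω} [IsProbabilityMeasure μ]
  {σ : ℝ} {W : Ω → ℝ}

/-- The sub-Gaussian bound with a constant parameter, integrated against a nonnegative function of
the past. -/
lemma lintegral_mul_exp_const_le (hm : m ≤ mΩ) (hW : Measurable W) {c : ℝ}
    (hi : Integrable (fun ω => Real.exp (c * W ω)) μ)
    (hc : ∀ᵐ ω ∂μ, (μ[fun ω' => Real.exp (c * W ω') | m]) ω ≤ Real.exp (σ ^ 2 * c ^ 2 / 2))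
    {Z : Ω → ENNReal} (hZ : Measurable[m] Z) :
    ∫⁻ ω, Z ω * ENNReal.ofReal (Real.exp (c * W ω - σ ^ 2 * c ^ 2 / 2)) ∂μ ≤ ∫⁻ ω, Z ω ∂μ := by
  set g : Ω → ENNReal := fun ω => ENNReal.ofReal (Real.exp (c * W ω - σ ^ 2 * c ^ 2 / 2)) with hg
  have hgm : Measurable g := by fun_prop
  have hZm : Measurable Z := hZ.mono hm le_rfl
  -- on the past σ-algebra, tilting by `g` does not increase the measure of any event
  have hle : (μ.withDensity g).trim hm ≤ μ.trim hm := by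
    refine Measure.le_iff.mpr fun A hA => ?_
    rw [trim_measurableSet_eq hm hA, trim_measurableSet_eq hm hA, withDensity_apply _ (hm A hA)]
    have hgi : Integrable (fun ω => Real.exp (c * W ω - σ ^ 2 * c ^ 2 / 2)) μ := by
      simp only [Real.exp_sub]
      exact hi.div_const _
    rw [← ofReal_integral_eq_lintegral_ofReal hgi.integrableOn
      (ae_of_all _ fun ω => (Real.exp_pos _).le), ← ofReal_measureReal]
    refine ENNReal.ofReal_le_ofReal ?_
    simp only [Real.exp_sub]
    rw [integral_div, div_le_iff₀ (Real.exp_pos _), ← setIntegral_condExp hm hi hA]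
    calc ∫ ω in A, (μ[fun ω' => Real.exp (c * W ω') | m]) ω ∂μ
        ≤ ∫ _ in A, Real.exp (σ ^ 2 * c ^ 2 / 2) ∂μ :=
          setIntegral_mono_ae integrable_condExp.integrableOn (integrable_const _).integrableOn hc
      _ = _ := by rw [setIntegral_const, smul_eq_mul]
  calc ∫⁻ ω, Z ω * g ω ∂μ = ∫⁻ ω, Z ω ∂(μ.withDensity g) := by
        rw [lintegral_withDensity_eq_lintegral_mul _ hgm hZm]
        simp only [Pi.mul_apply, mul_comm]
    _ = ∫⁻ ω, Z ω ∂((μ.withDensity g).trim hm) := (lintegral_trim hm hZ).symm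
    _ ≤ ∫⁻ ω, Z ω ∂(μ.trim hm) := lintegral_mono' hle le_rfl
    _ = ∫⁻ ω, Z ω ∂μ := lintegral_trim hm hZ

/-- The sub-Gaussian bound with a parameter `a` known in the past: simple functions are handled
piece by piece, and Fatou's lemma gives the general case. -/
lemma lintegral_mul_exp_le (hm : m ≤ mΩ) (hW : Measurable W)
    (hsub : ∀ c : ℝ, Integrable (fun ω => Real.exp (c * W ω)) μ ∧
      ∀ᵐ ω ∂μ, (μ[fun ω' => Real.exp (c * W ω') | m]) ω ≤ Real.exp (σ ^ 2 * c ^ 2 / 2))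
    {a : Ω → ℝ} (ha : Measurable[m] a) {Z : Ω → ENNReal} (hZ : Measurable[m] Z) :
    ∫⁻ ω, Z ω * ENNReal.ofReal (Real.exp (a ω * W ω - σ ^ 2 * a ω ^ 2 / 2)) ∂μ
      ≤ ∫⁻ ω, Z ω ∂μ := by
  have hZm : Measurable Z := hZ.mono hm le_rfl
  have hsimple : ∀ b : Ω → ℝ, Measurable[m] b → (Set.range b).Finite →
      ∫⁻ ω, Z ω * ENNReal.ofReal (Real.exp (b ω * W ω - σ ^ 2 * b ω ^ 2 / 2)) ∂μ
        ≤ ∫⁻ ω, Z ω ∂μ := by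
    intro b hb hfin
    have hbm : ∀ c, MeasurableSet[m] (b ⁻¹' {c}) := fun c => hb (measurableSet_singleton c)
    have hZc : ∀ c, Measurable[m] ((b ⁻¹' {c}).indicator Z) := fun c => hZ.indicator (hbm c)
    have hsum : ∀ ω, ∑ c ∈ hfin.toFinset, (b ⁻¹' {c}).indicator Z ω = Z ω := by
      intro ω
      rw [Finset.sum_eq_single (b ω)]
      · exact Set.indicator_of_mem (by simp) _
      · intro c _ hc
        exact Set.indicator_of_notMem (by simpa using hc.symm) _
      · intro h
        exact absurd (hfin.mem_toFinset.mpr (Set.mem_range_self ω)) h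
    calc ∫⁻ ω, Z ω * ENNReal.ofReal (Real.exp (b ω * W ω - σ ^ 2 * b ω ^ 2 / 2)) ∂μ
        = ∫⁻ ω, ∑ c ∈ hfin.toFinset, (b ⁻¹' {c}).indicator Z ω *
            ENNReal.ofReal (Real.exp (c * W ω - σ ^ 2 * c ^ 2 / 2)) ∂μ := by
          refine lintegral_congr fun ω => ?_
          rw [← hsum ω, Finset.sum_mul]
          refine Finset.sum_congr rfl fun c _ => ?_
          by_cases h : b ω = c
          · rw [h]
          · rw [Set.indicator_of_notMem (by simpa using h), zero_mul, zero_mul]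
      _ = ∑ c ∈ hfin.toFinset, ∫⁻ ω, (b ⁻¹' {c}).indicator Z ω *
            ENNReal.ofReal (Real.exp (c * W ω - σ ^ 2 * c ^ 2 / 2)) ∂μ := by
          refine lintegral_finsetSum _ fun c _ => ?_
          exact ((hZc c).mono hm le_rfl).mul (by fun_prop)
      _ ≤ ∑ c ∈ hfin.toFinset, ∫⁻ ω, (b ⁻¹' {c}).indicator Z ω ∂μ :=
          Finset.sum_le_sum fun c _ =>
            lintegral_mul_exp_const_le hm hW (hsub c).1 (hsub c).2 (hZc c)
      _ = ∫⁻ ω, Z ω ∂μ := by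
          rw [← lintegral_finsetSum _ fun c _ => (hZc c).mono hm le_rfl]
          exact lintegral_congr hsum
  obtain ⟨b, hbm, hbfin, hblim⟩ := @exists_finite_range_approx Ω m a ha
  set G : ℕ → Ω → ENNReal := fun n ω => Z ω * ENNReal.ofReal
    (Real.exp (b n ω * W ω - σ ^ 2 * b n ω ^ 2 / 2)) with hG
  have hlim : ∀ ω, Filter.Tendsto (fun n => G n ω) Filter.atTop
      (nhds (Z ω * ENNReal.ofReal (Real.exp (a ω * W ω - σ ^ 2 * a ω ^ 2 / 2)))) := by
    intro ω
    refine ENNReal.Tendsto.const_mul ?_ (Or.inl (by simp [Real.exp_pos]))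
    have hcont : Continuous fun x : ℝ =>
        ENNReal.ofReal (Real.exp (x * W ω - σ ^ 2 * x ^ 2 / 2)) :=
      ENNReal.continuous_ofReal.comp (by fun_prop)
    exact (hcont.tendsto _).comp (hblim ω)
  have hGm : ∀ n, Measurable (G n) := by
    intro n
    have : Measurable (b n) := (hbm n).mono hm le_rfl
    fun_prop
  calc _ = ∫⁻ ω, Filter.liminf (fun n => G n ω) Filter.atTop ∂μ :=
        lintegral_congr fun ω => (hlim ω).liminf_eq.symm
    _ ≤ Filter.liminf (fun n => ∫⁻ ω, G n ω ∂μ) Filter.atTop := lintegral_liminf_le hGm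
    _ ≤ ∫⁻ ω, Z ω ∂μ := Filter.liminf_le_of_le (by isBoundedDefault) fun x hb => by
        obtain ⟨n, hn⟩ := hb.exists
        exact hn.trans (hsimple _ (hbm n) (hbfin n))

lemma CondSubGaussian.of_norm_le_one (hm : m ≤ mΩ) {n : ℕ}
    {W : Ω → EuclideanSpace ℝ (Fin n)} (h : CondSubGaussian μ m σ W)
    {v : EuclideanSpace ℝ (Fin n)} (hv : ‖v‖ ≤ 1) (c : ℝ) :
    Integrable (fun ω => Real.exp (c * inner ℝ v (W ω))) μ ∧
    ∀ᵐ ω ∂μ, (μ[fun ω' => Real.exp (c * inner ℝ v (W ω')) | m]) ω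
      ≤ Real.exp (σ ^ 2 * c ^ 2 / 2) := by
  by_cases hv0 : v = 0
  · subst hv0
    simp only [inner_zero_left, mul_zero, Real.exp_zero, condExp_const hm]
    exact ⟨integrable_const _, ae_of_all _ fun ω => Real.one_le_exp (by positivity)⟩
  have hv' : 0 < ‖v‖ := norm_pos_iff.mpr hv0
  obtain ⟨u, hu, hvu⟩ : ∃ u : EuclideanSpace ℝ (Fin n), ‖u‖ = 1 ∧ v = ‖v‖ • u :=
    ⟨‖v‖⁻¹ • v, by rw [norm_smul, norm_inv, norm_norm, inv_mul_cancel₀ hv'.ne'],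
      by rw [smul_smul, mul_inv_cancel₀ hv'.ne', one_smul]⟩
  have e : ∀ ω, c * (inner ℝ v (W ω) : ℝ) = (c * ‖v‖) * inner ℝ u (W ω) := fun ω => by
    conv_lhs => rw [hvu, real_inner_smul_left]
    ring
  simp only [e]
  obtain ⟨h1, h2⟩ := h u hu (c * ‖v‖)
  refine ⟨h1, h2.mono fun ω hω => hω.trans (Real.exp_le_exp.mpr ?_)⟩
  have : ‖v‖ ^ 2 ≤ 1 := pow_le_one₀ hv'.le hv
  have h3 : (c * ‖v‖) ^ 2 ≤ c ^ 2 := by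
    rw [mul_pow]; exact mul_le_of_le_one_right (sq_nonneg c) this
  have := mul_le_mul_of_nonneg_left h3 (sq_nonneg σ)
  linarith

/-- The exponential supermartingale of the self-normalized noise, at its final time. -/
lemma lintegral_exp_selfNormalized_le_one {n d T : ℕ} {ℱ : Filtration ℕ mΩ}
    {X : ℕ → Ω → EuclideanSpace ℝ (Fin d)} {η : ℕ → Ω → EuclideanSpace ℝ (Fin n)}
    (hX : ∀ t ∈ Finset.Icc 1 T, Measurable[ℱ t] (X t))
    (hη : ∀ t ∈ Finset.Icc 1 T, Measurable[ℱ (t + 1)] (η t))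
    (hsub : ∀ t ∈ Finset.Icc 1 T, CondSubGaussian μ (ℱ t) σ (η t))
    (l : EuclideanSpace ℝ (Fin d)) {v : EuclideanSpace ℝ (Fin n)} (hv : ‖v‖ ≤ 1) :
    ∫⁻ ω, ENNReal.ofReal (Real.exp (∑ t ∈ Finset.Icc 1 T,
      ((inner ℝ l (X t ω) : ℝ) * inner ℝ v (η t ω) - σ ^ 2 * inner ℝ l (X t ω) ^ 2 / 2))) ∂μ
      ≤ 1 := by
  have hXl : ∀ t ∈ Finset.Icc 1 T, Measurable[ℱ t] fun ω => (inner ℝ l (X t ω) : ℝ) :=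
    fun t ht => (continuous_const.inner continuous_id).measurable.comp (hX t ht)
  have hηv : ∀ t ∈ Finset.Icc 1 T, Measurable[ℱ (t + 1)] fun ω => (inner ℝ v (η t ω) : ℝ) :=
    fun t ht => (continuous_const.inner continuous_id).measurable.comp (hη t ht)
  have hind : ∀ s ≤ T, ∫⁻ ω, ENNReal.ofReal (Real.exp (∑ t ∈ Finset.Icc 1 s,
      ((inner ℝ l (X t ω) : ℝ) * inner ℝ v (η t ω) - σ ^ 2 * inner ℝ l (X t ω) ^ 2 / 2))) ∂μ
      ≤ 1 := by
    intro s
    induction s with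
    | zero => simp
    | succ s ih =>
      intro hs
      have hmem : s + 1 ∈ Finset.Icc 1 T := Finset.mem_Icc.mpr ⟨by omega, hs⟩
      simp only [Finset.sum_Icc_succ_top (Nat.le_add_left 1 s), Real.exp_add,
        ENNReal.ofReal_mul (Real.exp_pos _).le]
      refine (lintegral_mul_exp_le (ℱ.le (s + 1)) ((hηv _ hmem).mono (ℱ.le _) le_rfl)
        ((hsub _ hmem).of_norm_le_one (ℱ.le _) hv) (hXl _ hmem) ?_).trans (ih (by omega))
      refine ENNReal.measurable_ofReal.comp (Real.measurable_exp.comp ?_)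
      refine Finset.measurable_fun_sum (m := ℱ (s + 1)) _ fun t ht => ?_
      rw [Finset.mem_Icc] at ht
      have ht' : t ∈ Finset.Icc 1 T := Finset.mem_Icc.mpr ⟨ht.1, by omega⟩
      have h1 := (hXl t ht').mono (ℱ.mono (show t ≤ s + 1 by omega)) le_rfl
      have h2 := (hηv t ht').mono (ℱ.mono (show t + 1 ≤ s + 1 by omega)) le_rfl
      exact (h1.mul h2).sub (((h1.pow_const 2).const_mul _).div_const _)
  exact hind T le_rfl

end Supermartingale

/-! ### Normal equations -/

lemma toEuclideanLin_vecMulVec {n d : ℕ} (v : EuclideanSpace ℝ (Fin n))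
    (l x : EuclideanSpace ℝ (Fin d)) :
    Matrix.toEuclideanLin (Matrix.vecMulVec v.ofLp l.ofLp) x = (inner ℝ l x : ℝ) • v := by
  ext i
  simp only [Matrix.ofLp_toLpLin, Matrix.toLin'_apply, Matrix.vecMulVec_mulVec,
    EuclideanSpace.inner_eq_star_dotProduct, star_trivial, WithLp.ofLp_smul]
  simp [dotProduct_comm, mul_comm]

/-- The normal equations of least squares, tested against a rank-one perturbation. -/
lemma IsOLS.normal_equation {n d T : ℕ} {x : ℕ → EuclideanSpace ℝ (Fin d)}
    {y : ℕ → EuclideanSpace ℝ (Fin n)} {A : Matrix (Fin n) (Fin d) ℝ} (h : IsOLS T x y A)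
    (v : EuclideanSpace ℝ (Fin n)) (l : EuclideanSpace ℝ (Fin d)) :
    ∑ t ∈ Finset.Icc 1 T,
      (inner ℝ l (x t) : ℝ) * inner ℝ v (y t - Matrix.toEuclideanLin A (x t)) = 0 := by
  set b := ∑ t ∈ Finset.Icc 1 T,
      (inner ℝ l (x t) : ℝ) * inner ℝ v (y t - Matrix.toEuclideanLin A (x t)) with hb
  set c := ∑ t ∈ Finset.Icc 1 T, (inner ℝ l (x t) : ℝ) ^ 2 * ‖v‖ ^ 2 with hc
  have hc0 : 0 ≤ c := Finset.sum_nonneg fun _ _ => by positivity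
  have hloss : ∀ s : ℝ, lsLoss T x y (A + s • Matrix.vecMulVec v.ofLp l.ofLp) =
      lsLoss T x y A - s * b + s ^ 2 / 2 * c := by
    intro s
    rw [hb, hc, lsLoss, lsLoss, Finset.mul_sum, Finset.mul_sum, ← Finset.sum_sub_distrib,
      ← Finset.sum_add_distrib]
    refine Finset.sum_congr rfl fun t _ => ?_
    rw [map_add, map_smul, LinearMap.add_apply, LinearMap.smul_apply, toEuclideanLin_vecMulVec,
      ← sub_sub, norm_sub_sq_real, smul_smul, real_inner_smul_right, norm_smul, mul_pow,
      Real.norm_eq_abs, sq_abs, real_inner_comm v]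
    ring
  -- the loss is quadratic in the step; `c + 1` avoids dividing by zero when `c = 0`
  have hmin := h (A + (b / (c + 1)) • Matrix.vecMulVec v.ofLp l.ofLp)
  rw [hloss] at hmin
  have hc1 : 0 < c + 1 := by linarith
  have e : b / (c + 1) * b - (b / (c + 1)) ^ 2 / 2 * c =
      b ^ 2 * ((c + 2) / (2 * (c + 1) ^ 2)) := by
    field_simp
    ring
  have h1 : b ^ 2 * ((c + 2) / (2 * (c + 1) ^ 2)) ≤ 0 := by linarith
  have h2 : 0 < (c + 2) / (2 * (c + 1) ^ 2) := by positivity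
  have h3 : b ^ 2 ≤ 0 := by
    by_contra hlt
    push Not at hlt
    linarith [mul_pos hlt h2]
  exact pow_eq_zero_iff two_ne_zero |>.mp (le_antisymm h3 (sq_nonneg b))

/-! ### The method of mixtures -/

/-- Averaging over a centred ball: if the symmetrized values of `f` around `x` are at least `c`,
so is its mean. -/
lemma mul_volume_le_setLIntegral_add {n : ℕ} {f : EuclideanSpace ℝ (Fin n) → ENNReal}
    (hf : Measurable f) (x : EuclideanSpace ℝ (Fin n)) (r : ℝ) {c : ENNReal}
    (h : ∀ u, 2 * c ≤ f (x + u) + f (x - u)) :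
    c * volume (Metric.closedBall (0 : EuclideanSpace ℝ (Fin n)) r) ≤
      ∫⁻ u in Metric.closedBall (0 : EuclideanSpace ℝ (Fin n)) r, f (x + u) := by
  set B := Metric.closedBall (0 : EuclideanSpace ℝ (Fin n)) r with hB
  have hBm : MeasurableSet B := Metric.isClosed_closedBall.measurableSet
  have hsymm : ∫⁻ u in B, f (x - u) = ∫⁻ u in B, f (x + u) := by
    rw [← lintegral_indicator hBm, ← lintegral_indicator hBm, ← lintegral_neg_eq_self]
    refine lintegral_congr fun u => ?_
    by_cases hu : u ∈ B
    · have hu' : -u ∈ B := by simpa [hB] using hu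
      rw [Set.indicator_of_mem hu, Set.indicator_of_mem hu', sub_neg_eq_add]
    · have hu' : -u ∉ B := by simpa [hB] using hu
      rw [Set.indicator_of_notMem hu, Set.indicator_of_notMem hu']
  have h2 : 2 * (c * volume B) ≤ 2 * ∫⁻ u in B, f (x + u) := by
    calc 2 * (c * volume B) = ∫⁻ _ in B, 2 * c := by rw [setLIntegral_const, mul_assoc]
      _ ≤ ∫⁻ u in B, (f (x + u) + f (x - u)) := lintegral_mono h
      _ = 2 * ∫⁻ u in B, f (x + u) := by
        rw [lintegral_add_left (f := fun u => f (x + u))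
          (hf.comp (measurable_const_add x)), hsymm, two_mul]
  exact (ENNReal.mul_le_mul_iff_right two_ne_zero ENNReal.ofNat_ne_top).mp h2

/-- Convexity of the exponential, for the symmetrized values of a quadratic form. -/
lemma two_mul_exp_le {a b c : ℝ} (h : 2 * c ≤ a + b) :
    2 * ENNReal.ofReal (Real.exp c) ≤
      ENNReal.ofReal (Real.exp a) + ENNReal.ofReal (Real.exp b) := by
  have h2 : (2 : ENNReal) = ENNReal.ofReal 2 := by simp
  rw [← ENNReal.ofReal_add (Real.exp_pos _).le (Real.exp_pos _).le, h2,
    ← ENNReal.ofReal_mul (by norm_num)]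
  refine ENNReal.ofReal_le_ofReal ?_
  have e1 : Real.exp a = Real.exp c * Real.exp (a - c) := by rw [← Real.exp_add]; ring_nf
  have e2 : Real.exp b = Real.exp c * Real.exp (b - c) := by rw [← Real.exp_add]; ring_nf
  have h3 := Real.add_one_le_exp (a - c)
  have h4 := Real.add_one_le_exp (b - c)
  rw [e1, e2, ← mul_add, mul_comm]
  exact mul_le_mul_of_nonneg_left (by linarith) (Real.exp_pos c).le

section Mixture

/-- The exponential supermartingale at its final time, in directions `v` and `l`, weighted by the
unnormalized centred Gaussian density `exp (-lᵀ V l)`. -/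
noncomputable def mixtureWeight {n d : ℕ} (σ : ℝ) (T : ℕ) (V : Matrix (Fin d) (Fin d) ℝ)
    (x : ℕ → EuclideanSpace ℝ (Fin d)) (e : ℕ → EuclideanSpace ℝ (Fin n))
    (v : EuclideanSpace ℝ (Fin n)) (l : EuclideanSpace ℝ (Fin d)) : ENNReal :=
  ENNReal.ofReal (Real.exp (∑ t ∈ Finset.Icc 1 T,
      ((inner ℝ l (x t) : ℝ) * inner ℝ v (e t) - σ ^ 2 * inner ℝ l (x t) ^ 2 / 2))) *
    ENNReal.ofReal (Real.exp (-quadForm V l))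

variable {n d T : ℕ} {σ : ℝ} {V R : Matrix (Fin d) (Fin d) ℝ}
  {x : ℕ → EuclideanSpace ℝ (Fin d)} {e : ℕ → EuclideanSpace ℝ (Fin n)}

/-- Completing the square in `l` bounds the mixture from below by the exponential of the energy of
the vector `w` that represents the noise. -/
lemma exp_energy_mul_gaussWeight_le (hσ : 0 < σ)
    (hV : ∀ l, quadForm V l ≤ σ ^ 2 / 2 * quadForm (gram T x) l)
    (hR : ∀ l, σ ^ 2 * quadForm (gram T x) l ≤ quadForm R l)
    {v : EuclideanSpace ℝ (Fin n)} {w : EuclideanSpace ℝ (Fin d)}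
    (hw : ∀ l : EuclideanSpace ℝ (Fin d),
      ∑ t ∈ Finset.Icc 1 T, (inner ℝ l (x t) : ℝ) * inner ℝ v (e t) =
        ∑ t ∈ Finset.Icc 1 T, (inner ℝ l (x t) : ℝ) * inner ℝ w (x t)) :
    ENNReal.ofReal (Real.exp (quadForm (gram T x) w / (4 * σ ^ 2))) * gaussWeight R ≤
      ∫⁻ l, mixtureWeight σ T V x e v l := by
  rw [← lintegral_add_right_eq_self _ ((1 / (2 * σ ^ 2)) • w), gaussWeight,
    ← lintegral_const_mul' _ _ ENNReal.ofReal_ne_top]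
  refine lintegral_mono fun u => ?_
  unfold mixtureWeight
  rw [← ENNReal.ofReal_mul (Real.exp_pos _).le, ← ENNReal.ofReal_mul (Real.exp_pos _).le,
    ← Real.exp_add, ← Real.exp_add]
  refine ENNReal.ofReal_le_ofReal (Real.exp_le_exp.mpr ?_)
  -- the shift is the maximiser of `l ↦ lᵀ S w - σ² lᵀ S l`
  set l := u + (1 / (2 * σ ^ 2)) • w with hl
  have h1 : ∑ t ∈ Finset.Icc 1 T,
      ((inner ℝ l (x t) : ℝ) * inner ℝ v (e t) - σ ^ 2 * inner ℝ l (x t) ^ 2 / 2) -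
        σ ^ 2 / 2 * quadForm (gram T x) l =
      quadForm (gram T x) w / (4 * σ ^ 2) - σ ^ 2 * quadForm (gram T x) u := by
    rw [Finset.sum_sub_distrib, hw, ← Finset.sum_sub_distrib, quadForm_gram, quadForm_gram,
      quadForm_gram, Finset.mul_sum, Finset.mul_sum, Finset.sum_div, ← Finset.sum_sub_distrib,
      ← Finset.sum_sub_distrib]
    refine Finset.sum_congr rfl fun t _ => ?_
    rw [hl, inner_add_left, real_inner_smul_left]
    field_simp
    ring
  linarith [hV l, hR u]

lemma measurable_mixtureWeight {α : Type*} [MeasurableSpace α]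
    {X : ℕ → α → EuclideanSpace ℝ (Fin d)} {η : ℕ → α → EuclideanSpace ℝ (Fin n)}
    (hX : ∀ t ∈ Finset.Icc 1 T, Measurable (X t)) (hη : ∀ t ∈ Finset.Icc 1 T, Measurable (η t)) :
    Measurable fun q : (α × EuclideanSpace ℝ (Fin n)) × EuclideanSpace ℝ (Fin d) =>
      mixtureWeight σ T V (fun t => X t q.1.1) (fun t => η t q.1.1) q.1.2 q.2 := by
  unfold mixtureWeight
  refine Measurable.mul ?_ (ENNReal.measurable_ofReal.comp (Real.measurable_exp.comp
    ((continuous_quadForm V).measurable.comp measurable_snd).neg))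
  refine ENNReal.measurable_ofReal.comp (Real.measurable_exp.comp ?_)
  refine Finset.measurable_fun_sum _ fun t ht => ?_
  have h1 : Measurable fun q : (α × EuclideanSpace ℝ (Fin n)) × EuclideanSpace ℝ (Fin d) =>
      (inner ℝ q.2 (X t q.1.1) : ℝ) :=
    measurable_snd.inner ((hX t ht).comp (measurable_fst.comp measurable_fst))
  have h2 : Measurable fun q : (α × EuclideanSpace ℝ (Fin n)) × EuclideanSpace ℝ (Fin d) =>
      (inner ℝ q.1.2 (η t q.1.1) : ℝ) :=
    (measurable_snd.comp measurable_fst).inner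
      ((hη t ht).comp (measurable_fst.comp measurable_fst))
  exact (h1.mul h2).sub (((h1.pow_const 2).const_mul _).div_const _)

/-- Averaging the mixture also over the directions `v` of the unit ball costs a factor `2 ^ n` and
gives a bound for all directions at once. -/
lemma exp_energy_mul_volume_le (hσ : 0 < σ)
    (hV : ∀ l, quadForm V l ≤ σ ^ 2 / 2 * quadForm (gram T x) l)
    (hR : ∀ l, σ ^ 2 * quadForm (gram T x) l ≤ quadForm R l)
    (L : EuclideanSpace ℝ (Fin n) →ₗ[ℝ] EuclideanSpace ℝ (Fin d))
    (hL : ∀ (v : EuclideanSpace ℝ (Fin n)) (l : EuclideanSpace ℝ (Fin d)),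
      ∑ t ∈ Finset.Icc 1 T, (inner ℝ l (x t) : ℝ) * inner ℝ v (e t) =
        ∑ t ∈ Finset.Icc 1 T, (inner ℝ l (x t) : ℝ) * inner ℝ (L v) (x t))
    {v₀ : EuclideanSpace ℝ (Fin n)} (hv₀ : ‖v₀‖ ≤ 1) :
    ENNReal.ofReal (Real.exp (quadForm (gram T x) (L v₀) / (16 * σ ^ 2))) *
        (ENNReal.ofReal ((1 / 2) ^ n) *
          volume (Metric.closedBall (0 : EuclideanSpace ℝ (Fin n)) 1)) * gaussWeight R ≤
      ∫⁻ v in Metric.closedBall (0 : EuclideanSpace ℝ (Fin n)) 1,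
        ∫⁻ l, mixtureWeight σ T V x e v l := by
  set G : EuclideanSpace ℝ (Fin n) → ENNReal := fun v =>
    ENNReal.ofReal (Real.exp (quadForm (gram T x) (L v) / (4 * σ ^ 2))) with hG
  have hLc : Continuous L := LinearMap.continuous_of_finiteDimensional L
  have hGm : Measurable G := by
    have : Continuous fun v => quadForm (gram T x) (L v) := (continuous_quadForm _).comp hLc
    exact ENNReal.measurable_ofReal.comp (by fun_prop)
  -- the ball of radius `1 / 2` around `v₀ / 2` stays in the unit ball; halving `v₀` quarters the
  -- energy
  set v₁ := (1 / 2 : ℝ) • v₀ with hv₁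
  have hv₁n : ‖v₁‖ ≤ 1 / 2 := by
    rw [hv₁, norm_smul]
    norm_num
    linarith
  have hvol : volume (Metric.closedBall (0 : EuclideanSpace ℝ (Fin n)) (1 / 2)) =
      ENNReal.ofReal ((1 / 2) ^ n) *
        volume (Metric.closedBall (0 : EuclideanSpace ℝ (Fin n)) 1) := by
    have := Measure.addHaar_closedBall' (volume : Measure (EuclideanSpace ℝ (Fin n)))
      (0 : EuclideanSpace ℝ (Fin n)) (r := 1 / 2) (by norm_num)
    simpa using this
  have havg := mul_volume_le_setLIntegral_add hGm v₁ (1 / 2)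
    (c := ENNReal.ofReal (Real.exp (quadForm (gram T x) (L v₀) / (16 * σ ^ 2)))) (fun u => by
      refine two_mul_exp_le ?_
      have h1 := quadForm_parallelogram (gram T x) (L v₁) (L u)
      have h2 := quadForm_nonneg (gram_posSemidef T x) (L u)
      have h3 : quadForm (gram T x) (L v₁) = 1 / 4 * quadForm (gram T x) (L v₀) := by
        rw [hv₁, map_smul, quadForm_smul]; norm_num
      rw [map_add, map_sub, ← add_div, h1, h3]
      rw [← mul_div_assoc, div_le_div_iff₀ (by positivity) (by positivity)]
      nlinarith [mul_nonneg h2 (sq_nonneg σ)])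
  rw [hvol] at havg
  calc _ ≤ (∫⁻ u in Metric.closedBall (0 : EuclideanSpace ℝ (Fin n)) (1 / 2), G (v₁ + u)) *
        gaussWeight R := by gcongr
    _ ≤ (∫⁻ v in Metric.closedBall (0 : EuclideanSpace ℝ (Fin n)) 1, G v) * gaussWeight R := by
        gcongr ?_ * _
        rw [← lintegral_indicator Metric.isClosed_closedBall.measurableSet,
          ← lintegral_indicator Metric.isClosed_closedBall.measurableSet,
          ← lintegral_add_left_eq_self (fun v => (Metric.closedBall _ _).indicator G v) v₁]
        refine lintegral_mono fun u => ?_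
        by_cases hu : u ∈ Metric.closedBall (0 : EuclideanSpace ℝ (Fin n)) (1 / 2)
        · have hu' : v₁ + u ∈ Metric.closedBall (0 : EuclideanSpace ℝ (Fin n)) 1 := by
            rw [mem_closedBall_zero_iff] at hu ⊢
            linarith [norm_add_le v₁ u]
          rw [Set.indicator_of_mem hu, Set.indicator_of_mem hu']
        · rw [Set.indicator_of_notMem hu]
          exact zero_le
    _ = ∫⁻ v in Metric.closedBall (0 : EuclideanSpace ℝ (Fin n)) 1, G v * gaussWeight R :=
        (lintegral_mul_const _ hGm).symm
    _ ≤ _ := lintegral_mono fun v => exp_energy_mul_gaussWeight_le hσ hV hR (hL v)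

variable {Ω : Type*} {mΩ : MeasurableSpace Ω} {μ : Measure Ω} [IsProbabilityMeasure μ]
  {X : ℕ → Ω → EuclideanSpace ℝ (Fin d)} {η : ℕ → Ω → EuclideanSpace ℝ (Fin n)}
  {ℱ : Filtration ℕ mΩ}

lemma lintegral_mixture_le (hX : ∀ t ∈ Finset.Icc 1 T, Measurable[ℱ t] (X t))
    (hη : ∀ t ∈ Finset.Icc 1 T, Measurable[ℱ (t + 1)] (η t))
    (hsub : ∀ t ∈ Finset.Icc 1 T, CondSubGaussian μ (ℱ t) σ (η t)) :
    ∫⁻ ω, (∫⁻ v in Metric.closedBall (0 : EuclideanSpace ℝ (Fin n)) 1,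
        ∫⁻ l, mixtureWeight σ T V (fun t => X t ω) (fun t => η t ω) v l) ∂μ ≤
      gaussWeight V * volume (Metric.closedBall (0 : EuclideanSpace ℝ (Fin n)) 1) := by
  have hXm : ∀ t ∈ Finset.Icc 1 T, Measurable (X t) := fun t ht => (hX t ht).mono (ℱ.le _) le_rfl
  have hηm : ∀ t ∈ Finset.Icc 1 T, Measurable (η t) := fun t ht => (hη t ht).mono (ℱ.le _) le_rfl
  have hm := measurable_mixtureWeight (σ := σ) (V := V) hXm hηm
  have hm' : Measurable (Function.uncurry fun ω v =>
      ∫⁻ l, mixtureWeight σ T V (fun t => X t ω) (fun t => η t ω) v l) :=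
    hm.lintegral_prod_right'
  rw [lintegral_lintegral_swap hm'.aemeasurable, ← setLIntegral_const]
  refine setLIntegral_mono' Metric.isClosed_closedBall.measurableSet fun v hv => ?_
  rw [mem_closedBall_zero_iff] at hv
  rw [lintegral_lintegral_swap]
  swap
  · exact (hm.comp (by fun_prop : Measurable fun q : Ω × EuclideanSpace ℝ (Fin d) =>
      ((q.1, v), q.2))).aemeasurable
  refine lintegral_mono fun l => ?_
  unfold mixtureWeight
  rw [lintegral_mul_const' _ _ ENNReal.ofReal_ne_top]
  exact mul_le_of_le_one_left zero_le (lintegral_exp_selfNormalized_le_one hX hη hsub l hv)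

/-- Self-normalized deviation bound: when the Gram matrix lies between its two deterministic
bounds, the energy of the linear map that represents the noise is rarely large in any direction. -/
lemma measure_energy_ge_le (hσ : 0 < σ) (hT : 0 < T) {p : ℝ} (hp0 : 0 < p)
    {Γsb Γbar : Matrix (Fin d) (Fin d) ℝ} (hΓ : Γsb.PosDef) (hΓle : LoewnerLE Γsb Γbar)
    (hX : ∀ t ∈ Finset.Icc 1 T, Measurable[ℱ t] (X t))
    (hη : ∀ t ∈ Finset.Icc 1 T, Measurable[ℱ (t + 1)] (η t))
    (hsub : ∀ t ∈ Finset.Icc 1 T, CondSubGaussian μ (ℱ t) σ (η t)) (κ : ℝ) :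
    μ {ω | LoewnerLE (gram T fun t => X t ω) ((T : ℝ) • Γbar) ∧
        (∀ w, T * p ^ 2 / 50 * quadForm Γsb w ≤ quadForm (gram T fun t => X t ω) w) ∧
        ∃ L : EuclideanSpace ℝ (Fin n) →ₗ[ℝ] EuclideanSpace ℝ (Fin d),
          (∀ (v : EuclideanSpace ℝ (Fin n)) (l : EuclideanSpace ℝ (Fin d)),
            ∑ t ∈ Finset.Icc 1 T, (inner ℝ l (X t ω) : ℝ) * inner ℝ v (η t ω) =
              ∑ t ∈ Finset.Icc 1 T, (inner ℝ l (X t ω) : ℝ) * inner ℝ (L v) (X t ω)) ∧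
          ∃ v₀, ‖v₀‖ ≤ 1 ∧ κ ≤ quadForm (gram T fun t => X t ω) (L v₀)}
      ≤ ENNReal.ofReal (2 ^ n * Real.sqrt ((100 / p ^ 2) ^ d * (Γbar * Γsb⁻¹).det) *
          Real.exp (-(κ / (16 * σ ^ 2)))) := by
  have hT' : (0 : ℝ) < T := by exact_mod_cast hT
  set V := (σ ^ 2 / 2 * (T * p ^ 2 / 50)) • Γsb with hV
  set R := (σ ^ 2 * T) • Γbar with hR
  have hVp : V.PosDef := hΓ.smul (by positivity)
  have hRp : R.PosDef := (posDef_of_loewnerLE hΓ hΓle).smul (by positivity)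
  set vol := volume (Metric.closedBall (0 : EuclideanSpace ℝ (Fin n)) 1) with hvol
  have hvol0 : vol ≠ 0 := (Metric.measure_closedBall_pos _ _ one_pos).ne'
  have hvolt : vol ≠ ⊤ := measure_closedBall_lt_top.ne
  set c := ENNReal.ofReal (Real.exp (κ / (16 * σ ^ 2))) *
        (ENNReal.ofReal ((1 / 2) ^ n) * vol) * gaussWeight R with hc
  set Φ : Ω → ENNReal := fun ω => ∫⁻ v in Metric.closedBall (0 : EuclideanSpace ℝ (Fin n)) 1,
        ∫⁻ l, mixtureWeight σ T V (fun t => X t ω) (fun t => η t ω) v l with hΦ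
  have hXm : ∀ t ∈ Finset.Icc 1 T, Measurable (X t) := fun t ht => (hX t ht).mono (ℱ.le _) le_rfl
  have hηm : ∀ t ∈ Finset.Icc 1 T, Measurable (η t) := fun t ht => (hη t ht).mono (ℱ.le _) le_rfl
  have hΦm : Measurable Φ :=
    (measurable_mixtureWeight (σ := σ) (V := V) hXm hηm).lintegral_prod_right'.lintegral_prod_right'
  have hc0 : c ≠ 0 := by
    refine mul_ne_zero (mul_ne_zero ?_ (mul_ne_zero ?_ hvol0)) (gaussWeight_ne_zero R)
    · simp [Real.exp_pos]
    · simp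
  have hct : c ≠ ⊤ := ENNReal.mul_ne_top (ENNReal.mul_ne_top ENNReal.ofReal_ne_top
    (ENNReal.mul_ne_top ENNReal.ofReal_ne_top hvolt)) (gaussWeight_ne_top hRp)
  refine (measure_mono (t := {ω | c ≤ Φ ω}) ?_).trans ?_
  · rintro ω ⟨hup, hlow, L, hL, v₀, hv₀, hκ⟩
    refine le_trans ?_ (exp_energy_mul_volume_le (R := R) hσ (fun l => ?_) (fun l => ?_) L hL hv₀)
    · rw [hc]
      gcongr
    · rw [hV, quadForm_smul_matrix, mul_assoc]
      exact mul_le_mul_of_nonneg_left (hlow l) (by positivity)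
    · have := hup.quadForm_le l
      rw [quadForm_smul_matrix] at this
      rw [hR, quadForm_smul_matrix, mul_assoc]
      exact mul_le_mul_of_nonneg_left this (by positivity)
  refine (meas_ge_le_lintegral_div hΦm.aemeasurable hc0 hct).trans ?_
  refine ENNReal.div_le_of_le_mul ((lintegral_mixture_le hX hη hsub).trans_eq ?_)
  have hratio : (σ ^ 2 * T) / (σ ^ 2 / 2 * (T * p ^ 2 / 50)) = 100 / p ^ 2 := by
    field_simp
    norm_num
  rw [hc, gaussWeight_ratio hVp hRp, hV, hR, det_smul_div_det_smul hΓ, hratio, ← hvol]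
  have hone : ENNReal.ofReal (2 ^ n * Real.sqrt ((100 / p ^ 2) ^ d * (Γbar * Γsb⁻¹).det) *
          Real.exp (-(κ / (16 * σ ^ 2)))) * ENNReal.ofReal (Real.exp (κ / (16 * σ ^ 2))) *
          ENNReal.ofReal ((1 / 2) ^ n) =
        ENNReal.ofReal (Real.sqrt ((100 / p ^ 2) ^ d * (Γbar * Γsb⁻¹).det)) := by
    rw [← ENNReal.ofReal_mul (by positivity), ← ENNReal.ofReal_mul (by positivity), Real.exp_neg,
      one_div, inv_pow]
    congr 1
    field_simp
  rw [← hone]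
  ring

end Mixture

/-! ### The error bound -/

/-- An operator norm above `r` is seen by the adjoint in some direction of the unit ball. -/
lemma exists_lt_norm_adjoint_of_lt_opNorm {n d : ℕ} (E : Matrix (Fin n) (Fin d) ℝ) {r : ℝ}
    (hr : 0 ≤ r) (h : r < opNorm E) :
    ∃ v : EuclideanSpace ℝ (Fin n), ‖v‖ ≤ 1 ∧ r < ‖(Matrix.toEuclideanLin E).adjoint v‖ := by
  by_contra hno
  push Not at hno
  refine absurd h (not_lt.mpr ?_)
  refine ContinuousLinearMap.opNorm_le_bound _ hr fun w => ?_
  rw [LinearMap.coe_toContinuousLinearMap']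
  set y := Matrix.toEuclideanLin E w with hy
  by_cases hy0 : y = 0
  · rw [hy0, norm_zero]; positivity
  have hy' : 0 < ‖y‖ := norm_pos_iff.mpr hy0
  have h1 := hno (‖y‖⁻¹ • y) (by rw [norm_smul, norm_inv, norm_norm, inv_mul_cancel₀ hy'.ne'])
  have h2 : ‖y‖ = inner ℝ ((Matrix.toEuclideanLin E).adjoint (‖y‖⁻¹ • y)) w := by
    rw [LinearMap.adjoint_inner_left, ← hy, real_inner_smul_left, real_inner_self_eq_norm_sq, sq,
      inv_mul_cancel_left₀ hy'.ne']
  rw [h2]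
  exact (real_inner_le_norm _ _).trans (mul_le_mul_of_nonneg_right h1 (norm_nonneg _))

/-- The deviation probability at the energy level that corresponds to the claimed error bound:
`162 σ²` is `90² σ² / p²` times the factor `p² / 50` of the lower bound on the Gram matrix. -/
lemma deviation_le {n d : ℕ} {p δ D σ : ℝ} (hσ : 0 < σ) (hp0 : 0 < p) (hp1 : p ≤ 1)
    (hδ0 : 0 < δ) (hδ1 : δ < 1) (hD : 1 ≤ D) :
    2 ^ n * Real.sqrt ((100 / p ^ 2) ^ d * D) * Real.exp (-((162 * σ ^ 2 *
      (n + d * Real.log (10 / p) + Real.log D + Real.log (1 / δ))) / (16 * σ ^ 2))) ≤ δ := by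
  set H := n + d * Real.log (10 / p) + Real.log D + Real.log (1 / δ) with hH
  have hD0 : 0 < D := by linarith
  have hp10 : 1 ≤ 10 / p := by rw [le_div_iff₀ hp0]; linarith
  have h1 : 0 ≤ (d : ℝ) * Real.log (10 / p) := mul_nonneg (by positivity) (Real.log_nonneg hp10)
  have h2 : 0 ≤ Real.log D := Real.log_nonneg hD
  have h3 : 0 ≤ Real.log (1 / δ) := Real.log_nonneg (by rw [le_div_iff₀ hδ0]; linarith)
  have hH0 : 0 ≤ H := by positivity
  have hexp : (162 * σ ^ 2 * H) / (16 * σ ^ 2) = 81 / 8 * H := by field_simp; ring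
  have hsqrt : Real.sqrt ((100 / p ^ 2) ^ d * D) ≤ (10 / p) ^ d * D := by
    rw [Real.sqrt_le_left (by positivity), mul_pow, ← pow_mul, mul_comm d 2, pow_mul]
    have e : (10 / p) ^ 2 = 100 / p ^ 2 := by rw [div_pow]; norm_num
    rw [e]
    gcongr
    nlinarith
  have htwo : (2 : ℝ) ^ n ≤ Real.exp n := by
    rw [← Real.exp_one_pow]
    gcongr
    linarith [Real.exp_one_gt_d9]
  have hHexp : Real.exp n * ((10 / p) ^ d * D) = Real.exp H * δ := by
    rw [hH, Real.exp_add, Real.exp_add, Real.exp_add, Real.exp_log hD0, Real.exp_nat_mul,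
      Real.exp_log (by positivity), Real.exp_log (by positivity)]
    field_simp
  rw [hexp]
  calc _ ≤ Real.exp n * ((10 / p) ^ d * D) * Real.exp (-H) := by
        gcongr
        linarith
    _ = δ := by
        rw [hHexp, mul_right_comm, ← Real.exp_add, add_neg_cancel, Real.exp_zero, one_mul]

lemma opNorm_eq_zero_of_dim_zero {n : ℕ} (E : Matrix (Fin n) (Fin 0) ℝ) : opNorm E = 0 := by
  unfold opNorm
  rw [norm_eq_zero]
  ext x
  simp [Subsingleton.elim x 0]

lemma CondSubGaussian.mono {Ω : Type*} {m mΩ : MeasurableSpace Ω} {μ : Measure Ω} {n : ℕ}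
    {σ τ : ℝ} (hσ : 0 ≤ σ) (hστ : σ ≤ τ) {W : Ω → EuclideanSpace ℝ (Fin n)}
    (h : CondSubGaussian μ m σ W) : CondSubGaussian μ m τ W := fun v hv c =>
  ⟨(h v hv c).1, (h v hv c).2.mono fun ω hω => hω.trans (Real.exp_le_exp.mpr (by gcongr))⟩

/-- The estimation bound at a positive noise level. The bad event is covered by three events: the
Gram matrix exceeds its upper bound, it misses its lower bound, or the self-normalized noise is
large. -/
lemma measure_opNorm_gt_le_of_pos {Ω : Type*} {mΩ : MeasurableSpace Ω} {μ : Measure Ω}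
    [IsProbabilityMeasure μ] {n d T k : ℕ} (hk : 1 ≤ k) {σ p δ : ℝ} (hσ : 0 < σ) (hp0 : 0 < p)
    (hp1 : p ≤ 1) (hδ0 : 0 < δ) (hδ1 : δ < 1)
    {Γsb Γbar : Matrix (Fin d) (Fin d) ℝ} (hΓsb : Γsb.PosDef) (hΓ : LoewnerLE Γsb Γbar)
    {Astar : Matrix (Fin n) (Fin d) ℝ}
    {X : ℕ → Ω → EuclideanSpace ℝ (Fin d)} {η Y : ℕ → Ω → EuclideanSpace ℝ (Fin n)}
    {ℱ : Filtration ℕ mΩ}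
    (hX : ∀ t ∈ Finset.Icc 1 T, Measurable[ℱ t] (X t))
    (hη : ∀ t ∈ Finset.Icc 1 T, Measurable[ℱ (t + 1)] (η t))
    (hY : ∀ t ∈ Finset.Icc 1 T, ∀ ω, Y t ω = Matrix.toEuclideanLin Astar (X t ω) + η t ω)
    (hsub : ∀ t ∈ Finset.Icc 1 T, CondSubGaussian μ (ℱ t) σ (η t))
    (hsb : IsVectorBMSB μ ℱ T k Γsb p X)
    (hcov : μ {ω | ¬ LoewnerLE (gram T (fun t => X t ω)) ((T : ℝ) • Γbar)} ≤ ENNReal.ofReal δ)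
    (hT : (T : ℝ) ≥ 10 * (k : ℝ) / p ^ 2 *
      (Real.log (1 / δ) + 2 * (d : ℝ) * Real.log (10 / p)
        + Real.log (Matrix.det (Γbar * Γsb⁻¹))))
    {Ahat : Ω → Matrix (Fin n) (Fin d) ℝ}
    (hAhat : ∀ ω, IsOLS T (fun t => X t ω) (fun t => Y t ω) (Ahat ω)) :
    μ {ω | opNorm (Ahat ω - Astar) >
        90 * σ / p * Real.sqrt
          (((n : ℝ) + (d : ℝ) * Real.log (10 / p) + Real.log (Matrix.det (Γbar * Γsb⁻¹))
              + Real.log (1 / δ))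
            / ((T : ℝ) * lambdaMin Γsb))}
      ≤ ENNReal.ofReal (3 * δ) := by
  have hD := one_le_det_mul_inv hΓsb hΓ
  set D := (Γbar * Γsb⁻¹).det with hDdef
  set H := (n : ℝ) + (d : ℝ) * Real.log (10 / p) + Real.log D + Real.log (1 / δ) with hH
  set r := 90 * σ / p * Real.sqrt (H / ((T : ℝ) * lambdaMin Γsb)) with hr
  have hr0 : 0 ≤ r := by positivity
  rcases Nat.eq_zero_or_pos d with rfl | hd
  · have : {ω | opNorm (Ahat ω - Astar) > r} = ∅ := by
      ext ω
      simp [opNorm_eq_zero_of_dim_zero, hr0]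
    rw [this, measure_empty]
    exact zero_le
  have hp10 : 1 ≤ 10 / p := by rw [le_div_iff₀ hp0]; linarith
  have hlogp : 0 ≤ Real.log (10 / p) := Real.log_nonneg hp10
  have hlogD : 0 ≤ Real.log D := Real.log_nonneg hD
  have hlogδ : 0 < Real.log (1 / δ) := Real.log_pos (by rw [lt_div_iff₀ hδ0]; linarith)
  have hH0 : 0 ≤ H := by positivity
  have hk' : (0 : ℝ) < k := by exact_mod_cast hk
  have hT' : (0 : ℝ) < T := lt_of_lt_of_le (by positivity) hT
  have hTpos : 0 < T := by exact_mod_cast hT'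
  have hlam := lambdaMin_pos hd.ne' hΓsb
  have hXm : ∀ t ∈ Finset.Icc 1 T, Measurable (X t) := fun t ht => (hX t ht).mono (ℱ.le _) le_rfl
  obtain ⟨hc, hδ'⟩ := block_count_bounds hk hd hp0 hp1 hδ0 hδ1 hD hT
  have hlow := (hsb.measure_exists_deficient_le hk hXm hTpos hΓsb hΓ hp0 hp1
    (Nat.div_mul_le_self T k) hc).trans (ENNReal.ofReal_le_ofReal hδ')
  have hdev := (measure_energy_ge_le hσ hTpos hp0 hΓsb hΓ hX hη hsub (162 * σ ^ 2 * H)).trans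
    (ENNReal.ofReal_le_ofReal (deviation_le hσ hp0 hp1 hδ0 hδ1 hD))
  have h3 : ENNReal.ofReal (3 * δ) =
      ENNReal.ofReal δ + ENNReal.ofReal δ + ENNReal.ofReal δ := by
    rw [← ENNReal.ofReal_add hδ0.le hδ0.le, ← ENNReal.ofReal_add (by positivity) hδ0.le]
    ring_nf
  rw [h3]
  refine le_trans ?_ (add_le_add (add_le_add hcov hlow) hdev)
  refine le_trans (measure_mono ?_) ((measure_union_le _ _).trans
    (add_le_add_left (measure_union_le _ _) _))
  intro ω hω
  by_cases hup : LoewnerLE (gram T fun t => X t ω) ((T : ℝ) • Γbar)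
  swap
  · exact Or.inl (Or.inl hup)
  by_cases hex : ∃ w, quadForm (gram T fun t => X t ω) w < T * p ^ 2 / 50 * quadForm Γsb w
  · exact Or.inl (Or.inr ⟨hup, hex⟩)
  push Not at hex
  refine Or.inr ⟨hup, hex, (Matrix.toEuclideanLin (Ahat ω - Astar)).adjoint, fun v l => ?_, ?_⟩
  · have hn := (hAhat ω).normal_equation v l
    rw [← sub_eq_zero, ← Finset.sum_sub_distrib, ← hn]
    refine Finset.sum_congr rfl fun t ht => ?_
    rw [LinearMap.adjoint_inner_left, ← mul_sub, ← inner_sub_right, hY t ht ω, map_sub,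
      LinearMap.sub_apply]
    congr 2
    abel
  · obtain ⟨v, hv, hlt⟩ := exists_lt_norm_adjoint_of_lt_opNorm _ hr0 hω
    refine ⟨v, hv, ?_⟩
    set w := (Matrix.toEuclideanLin (Ahat ω - Astar)).adjoint v with hw
    have hr2 : r ^ 2 = 8100 * σ ^ 2 / p ^ 2 * (H / (T * lambdaMin Γsb)) := by
      rw [hr, mul_pow, Real.sq_sqrt (by positivity), div_pow, mul_pow]
      norm_num
    calc 162 * σ ^ 2 * H = T * p ^ 2 / 50 * (lambdaMin Γsb * r ^ 2) := by
          rw [hr2]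
          field_simp
          ring
      _ ≤ T * p ^ 2 / 50 * (lambdaMin Γsb * ‖w‖ ^ 2) := by gcongr
      _ ≤ T * p ^ 2 / 50 * quadForm Γsb w := by
          gcongr
          exact quadForm_ge_lambdaMin hΓsb w
      _ ≤ _ := hex w

theorem theorem3 {Ω : Type*} {mΩ : MeasurableSpace Ω} (μ : Measure Ω) [IsProbabilityMeasure μ]
    (n d T k : ℕ) (hk : 1 ≤ k)
    (σ p δ : ℝ) (hσ : 0 ≤ σ) (hp0 : 0 < p) (hp1 : p ≤ 1) (hδ0 : 0 < δ) (hδ1 : δ < 1)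
    (Γsb Γbar : Matrix (Fin d) (Fin d) ℝ) (hΓsb : Γsb.PosDef) (hΓ : LoewnerLE Γsb Γbar)
    (Astar : Matrix (Fin n) (Fin d) ℝ)
    (X : ℕ → Ω → EuclideanSpace ℝ (Fin d))
    (η Y : ℕ → Ω → EuclideanSpace ℝ (Fin n))
    (ℱ : Filtration ℕ mΩ)
    (hX : ∀ t ∈ Finset.Icc 1 T, Measurable[ℱ t] (X t))
    (hη : ∀ t ∈ Finset.Icc 1 T, Measurable[ℱ (t + 1)] (η t))
    (hY : ∀ t ∈ Finset.Icc 1 T, ∀ ω, Y t ω = Matrix.toEuclideanLin Astar (X t ω) + η t ω)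
    (hmean : ∀ t ∈ Finset.Icc 1 T, CondMeanZero μ (ℱ t) (η t))
    (hsub : ∀ t ∈ Finset.Icc 1 T, CondSubGaussian μ (ℱ t) σ (η t))
    (hsb : IsVectorBMSB μ ℱ T k Γsb p X)
    (hcov : μ {ω | ¬ LoewnerLE (gram T (fun t => X t ω)) ((T : ℝ) • Γbar)} ≤ ENNReal.ofReal δ)
    (hT : (T : ℝ) ≥ 10 * (k : ℝ) / p ^ 2 *
      (Real.log (1 / δ) + 2 * (d : ℝ) * Real.log (10 / p)
        + Real.log (Matrix.det (Γbar * Γsb⁻¹))))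
    (Ahat : Ω → Matrix (Fin n) (Fin d) ℝ)
    (hAhat : ∀ ω, IsOLS T (fun t => X t ω) (fun t => Y t ω) (Ahat ω)) :
    μ {ω | opNorm (Ahat ω - Astar) >
        90 * σ / p * Real.sqrt
          (((n : ℝ) + (d : ℝ) * Real.log (10 / p) + Real.log (Matrix.det (Γbar * Γsb⁻¹))
              + Real.log (1 / δ))
            / ((T : ℝ) * lambdaMin Γsb))}
      ≤ ENNReal.ofReal (3 * δ) := by
  set R := Real.sqrt (((n : ℝ) + (d : ℝ) * Real.log (10 / p)
    + Real.log (Matrix.det (Γbar * Γsb⁻¹)) + Real.log (1 / δ)) / ((T : ℝ) * lambdaMin Γsb)) with hR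
  have hR0 : 0 ≤ R := Real.sqrt_nonneg _
  -- the case `σ = 0` is reached as a limit of positive noise levels
  set τ : ℕ → ℝ := fun j => σ + 1 / ((j : ℝ) + 1) with hτ
  have hτpos : ∀ j, 0 < τ j := fun j => by positivity
  set s : ℕ → Set Ω := fun j => {ω | opNorm (Ahat ω - Astar) > 90 * τ j / p * R} with hs
  have hbound : ∀ j, μ (s j) ≤ ENNReal.ofReal (3 * δ) := fun j =>
    measure_opNorm_gt_le_of_pos hk (hτpos j) hp0 hp1 hδ0 hδ1 hΓsb hΓ hX hη hY
      (fun t ht => (hsub t ht).mono hσ (le_add_of_nonneg_right (by positivity))) hsb hcov hT hAhat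
  have hmono : Monotone s := by
    intro i j hij ω hω
    have hω' : 90 * τ i / p * R < opNorm (Ahat ω - Astar) := hω
    refine lt_of_le_of_lt (b := 90 * τ i / p * R) ?_ hω'
    have : τ j ≤ τ i := add_le_add_right (Nat.one_div_le_one_div hij) σ
    gcongr
  have hlim : Filter.Tendsto (fun j => 90 * τ j / p * R) Filter.atTop (nhds (90 * σ / p * R)) := by
    have : Filter.Tendsto τ Filter.atTop (nhds σ) := by
      simpa [hτ] using tendsto_one_div_add_atTop_nhds_zero_nat.const_add σ
    exact ((this.const_mul 90).div_const p).mul_const R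
  calc _ ≤ μ (⋃ j, s j) := by
        refine measure_mono fun ω hω => Set.mem_iUnion.mpr ?_
        exact (hlim.eventually_lt_const hω).exists
    _ = ⨆ j, μ (s j) := hmono.measure_iUnion
    _ ≤ _ := iSup_le hbound
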